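/- Theorem 4.3. Let $d,n\ge 1$ and $p\ge2$. For every $\lambda\in\mathbb R^d$ let $Z(\lambda)$ be an $\mathbb R^n$-valued random variable with Lebesgue density $f(\lambda,\cdot)$; fix $\lambda^0\in\mathbb R^d$ and $\phi\in L^\infty(\mathbb R^n,\mathbb R)$, and put $Z^0=Z(\lambda^0)$, $V(\lambda)=\mathbb E[\phi(Z(\lambda))]$ and $\beta=\nabla V(\lambda^0)$. Let $K:\mathbb R^d\to\mathbb R$ be $C^1$, supported in $[-1,1]^d$, with $\int K=1$ and of order $p$, i.e. $\int l_{\alpha_1}\cdots l_{\alpha_r}K(l)\,dl=0$ for all $0<r<p$ and all indices $\alpha_k\in\{1,\dots,d\}$, while $\int l_{j_1}\cdots l_{j_p}K(l)\,dl\neq0$ for some indices $j_1,\dots,j_p$. Assume that for every $z$ the function $f(\cdot,z)$ is $p+1$ times differentiable and that, for some set $S$ with $\mathrm{Supp}(\phi)\subset\mathrm{int}(S)$ and every integer $0\le i\le p+1$, the function $\lambda\mapsto\nabla^i_\lambda f(\lambda,z)$ is continuous at $\lambda^0$ uniformly in $z\in S$. Let $h=h_N>0$ and, for every $N$, let $(\Lambda_i,Z_i)_{1\le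 i\le N}$ be i.i.d. with density $(\lambda,z)\mapsto \ell(\lambda^0-\lambda)f(\lambda,z)$, where $\ell$ is the uniform density on $[-h,h]^d$. Put $$\hat\beta^u_N=\frac{2^d}{Nh}\sum_{i=1}^N\phi(Z_i)\,\nabla K\Big(\frac{\lambda^0-\Lambda_i}{h}\Big),\qquad \Sigma_u=2^d\,\mathbb E[\phi^2(Z^0)]\int\nabla K(l)\,\nabla K(l)'\,dl .$$ (i) If $h\to0$ and $Nh^2\to\infty$ as $N\to\infty$, then $\hat\beta^u_N$ is integrable and $\sqrt{Nh^2}\,(\hat\beta^u_N-\mathbb E[\hat\beta^u_N])\to\mathcal N(0,\Sigma_u)$ in distribution. (ii) Suppose in addition that $Nh^{2p+2}\to0$ and that either $\phi$ is Lebesgue integrable (for instance, $\phi$ has bounded support) or there are $r>0$ and a Lebesgue integrable function $g$ on $\mathbb R^n$ such that, for almost every $z$, $|\phi(z)|\,\|\nabla^{p+1}_\lambda f(\lambda,z)\|\le g(z)$ for all $|\lambda-\lambda^0|<r$. Then $V$ is differentiable at $\lambda^0$, the bias vanishes, namely $\mathbb E[\hat\beta^u_N]\to\beta$ and even $\sqrt{Nh^2}\,(\mathbb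 E[\hat\beta^u_N]-\beta)\to0$, and $\sqrt{Nh^2}\,(\hat\beta^u_N-\beta)\to\mathcal N(0,\Sigma_u)$ in distribution. In particular, the rate $\sqrt{Nh^2}$ does not depend on the dimension $d$. -/

import Mathlib

open MeasureTheory ProbabilityTheory Filter Topology

noncomputable section

/-- `g` is `k` times differentiable on the whole space: the iterated derivatives of every
order `< k` are differentiable everywhere (the `k`-th one need not be continuous). -/
def TimesDifferentiable {d : ℕ} (k : ℕ) (g : EuclideanSpace ℝ (Fin d) → ℝ) : Prop :=
  ∀ i < k, Differentiable ℝ (iteratedFDeriv ℝ i g)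

/-- The kernel `K` is of order `p`: `p` is the smallest positive integer for which some moment
`∫ l_{j_1} ⋯ l_{j_p} K(l) dl` does not vanish. -/
def IsKernelOfOrder {d : ℕ} (K : EuclideanSpace ℝ (Fin d) → ℝ) (p : ℕ) : Prop :=
  0 < p ∧
  (∀ r : ℕ, 0 < r → r < p → ∀ α : Fin r → Fin d,
    ∫ l : EuclideanSpace ℝ (Fin d), (∏ k, l (α k)) * K l = 0) ∧
  ∃ j : Fin p → Fin d, ∫ l : EuclideanSpace ℝ (Fin d), (∏ k, l (j k)) * K l ≠ 0

/-- Conditions on the kernel: `K` is `C¹`, vanishes outside the cube `[-1, 1]^d`, has integral one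
and is of order `p ≥ 2`. -/
structure KernelAssumption {d : ℕ} (K : EuclideanSpace ℝ (Fin d) → ℝ) (p : ℕ) : Prop where
  contDiff : ContDiff ℝ 1 K
  support_subset : Function.support K ⊆ {l | ∀ j, |l j| ≤ 1}
  integral_eq_one : ∫ l, K l = 1
  two_le : 2 ≤ p
  order : IsKernelOfOrder K p

/-- Regularity of the parametric density `f` at `lam0`, relative to the support of `φ`: each
`f(·, z)` is `p + 1` times differentiable and, for some set `S` whose interior contains the
support of `φ`, all the derivatives `∇^i_λ f(λ, z)`, `i ≤ p + 1`, are continuous in `λ` at `lam0`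
uniformly with respect to `z ∈ S`. -/
structure RegularityAssumption {d n : ℕ}
    (f : EuclideanSpace ℝ (Fin d) → EuclideanSpace ℝ (Fin n) → ℝ)
    (φ : EuclideanSpace ℝ (Fin n) → ℝ) (lam0 : EuclideanSpace ℝ (Fin d)) (p : ℕ) : Prop where
  timesDifferentiable : ∀ z, TimesDifferentiable (p + 1) (fun lam => f lam z)
  uniform_continuity : ∃ S : Set (EuclideanSpace ℝ (Fin n)), tsupport φ ⊆ interior S ∧
    ∀ i ≤ p + 1, TendstoUniformlyOn
      (fun lam z => iteratedFDeriv ℝ i (fun l => f l z) lam)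
      (fun z => iteratedFDeriv ℝ i (fun l => f l z) lam0) (𝓝 lam0) S

/-- Near `lam0`, the functions `z ↦ φ(z) ∇^k_λ f(λ, z)` are dominated by one Lebesgue integrable
function of `z`. -/
def LocallyDominated {d n : ℕ} (k : ℕ)
    (f : EuclideanSpace ℝ (Fin d) → EuclideanSpace ℝ (Fin n) → ℝ)
    (φ : EuclideanSpace ℝ (Fin n) → ℝ) (lam0 : EuclideanSpace ℝ (Fin d)) : Prop :=
  ∃ r > 0, ∃ g : EuclideanSpace ℝ (Fin n) → ℝ, Integrable g ∧
    ∀ᵐ z, ∀ lam ∈ Metric.ball lam0 r,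
      |φ z| * ‖iteratedFDeriv ℝ k (fun l => f l z) lam‖ ≤ g z

/-- The uniform probability density on the cube `[-ε, ε]^d`. -/
def uniformCubeDensity (d : ℕ) (ε : ℝ) (l : EuclideanSpace ℝ (Fin d)) : ℝ :=
  open Classical in if ∀ j, |l j| ≤ ε then ((2 * ε) ^ d)⁻¹ else 0

/-- The joint law on `ℝ^d × ℝ^n` with density `ℓ(lam0 - λ) f(λ, z)`: the randomized parameter has
density `ℓ(lam0 - ·)`, and given its value `λ` the observation has density `f(λ, ·)`. -/
def randomizedLaw {d n : ℕ} (ℓ : EuclideanSpace ℝ (Fin d) → ℝ)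
    (f : EuclideanSpace ℝ (Fin d) → EuclideanSpace ℝ (Fin n) → ℝ)
    (lam0 : EuclideanSpace ℝ (Fin d)) :
    Measure (EuclideanSpace ℝ (Fin d) × EuclideanSpace ℝ (Fin n)) :=
  (volume : Measure (EuclideanSpace ℝ (Fin d) × EuclideanSpace ℝ (Fin n))).withDensity
    (fun q => ENNReal.ofReal (ℓ (lam0 - q.1) * f q.1 q.2))

/-- The estimator `(2^d / (N h)) ∑ φ(Z_i) ∇K((lam0 - Λ_i) / h)` computed from the sample
`(L_i, z_i)`, `i < N`. -/
def uniformKernelEstimator {d n : ℕ} (K : EuclideanSpace ℝ (Fin d) → ℝ)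
    (φ : EuclideanSpace ℝ (Fin n) → ℝ) (lam0 : EuclideanSpace ℝ (Fin d)) (N : ℕ) (h : ℝ)
    (L : Fin N → EuclideanSpace ℝ (Fin d)) (z : Fin N → EuclideanSpace ℝ (Fin n)) :
    EuclideanSpace ℝ (Fin d) :=
  ((2 : ℝ) ^ d / (N * h)) • ∑ i, φ (z i) • gradient K (h⁻¹ • (lam0 - L i))

/-- The matrix `2^d m ∫ ∇K ∇Kᵀ`; below, `m` is the second moment `E[φ²(Z⁰)]`. -/
def asymptoticCovariance {d : ℕ} (K : EuclideanSpace ℝ (Fin d) → ℝ) (m : ℝ) :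
    Matrix (Fin d) (Fin d) ℝ :=
  Matrix.of fun j k => (2 : ℝ) ^ d * m * ∫ l, gradient K l j * gradient K l k

end

/-! Rescaling the parameter by the bandwidth drives everything. Since `K` lives on the unit cube,
the uniform density is the constant `(2h)^{-d}` wherever the score is nonzero, and the Jacobian
`h^d` cancels it. Moments of `φ(Z) ∇K((lam0 - Λ)/h)` therefore equal `2^{-d} ∫ k(l) E[ψ(Z(lam0 - h
l))] dl` (`IsDensityFamily.integral_randomizedLaw`), with no power of `h` left. This is why the rate
is free of the dimension.

For (i), the normalized centred estimator is `N^{-1/2}` times a sum of uniformly bounded i.i.d.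
centred vectors whose law varies with `N`. A characteristic function argument gives the limit once
the variances converge. For that it suffices that means of bounded functions are continuous at
`lam0`, which follows from Scheffé's lemma; the squared mean disappears because `∫ ∇K = 0`.

For (ii), expand `f(·, z)` to order `p + 1` at `lam0`, weight by `φ(z)` and integrate over `z`. The
individual Taylor coefficients are not assumed integrable after weighting, but the remainder is
dominated, so the weighted Taylor polynomial is integrable in `z` at each point near `lam0`. An
average of polynomials of bounded degree is again such a polynomial
(`integral_mem_of_finiteDimensional`). Hence `V` is a polynomial near `lam0` up to `O(‖u‖^(p+1))`,
and in particular differentiable there. Integration by parts shows that `∇K` annihilates constants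
and monomials of degrees `2` to `p`, and picks out the linear coefficients. The bias is thus
`O(h^p)`, and `√(N h²) h^p = √(N h^(2p+2))` tends to zero; Slutsky's lemma concludes. -/

/-! ### A central limit theorem for bounded triangular arrays -/

section CentralLimit

open scoped RealInnerProductSpace

/-- Second-order Taylor bound for `exp (i x)` near zero. -/
theorem norm_exp_mul_I_sub_taylor_two_le {x : ℝ} (hx : |x| ≤ 1) :
    ‖Complex.exp (x * Complex.I) - (1 + x * Complex.I - (x : ℂ) ^ 2 / 2)‖ ≤ |x| ^ 3 := by
  have hn : ‖(x * Complex.I : ℂ)‖ = |x| := by simp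
  have h := Complex.exp_bound (x := x * Complex.I) (by rw [hn]; exact hx) (n := 3) (by norm_num)
  rw [hn] at h
  have e : ∑ m ∈ Finset.range 3, (x * Complex.I : ℂ) ^ m / (m.factorial : ℂ)
      = 1 + x * Complex.I - (x : ℂ) ^ 2 / 2 := by
    simp [Finset.sum_range_succ, mul_pow]
    ring
  rw [e] at h
  refine h.trans ?_
  have : (0 : ℝ) ≤ |x| ^ 3 := by positivity
  norm_num [Nat.factorial]
  nlinarith

variable {E : Type*} [NormedAddCommGroup E] [InnerProductSpace ℝ E] [MeasurableSpace E]
  [BorelSpace E] [SecondCountableTopology E]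

/-- Second-order expansion of the characteristic function of a bounded centred law. -/
theorem norm_charFun_sub_taylor_two_le {ν : Measure E} [IsProbabilityMeasure ν] {C : ℝ}
    (hC : ∀ᵐ x ∂ν, ‖x‖ ≤ C) (hmean : ∀ t : E, ∫ x, ⟪x, t⟫ ∂ν = 0) {s : E} (hs : C * ‖s‖ ≤ 1) :
    ‖charFun ν s - (1 - ((∫ x, ⟪x, s⟫ ^ 2 ∂ν : ℝ) : ℂ) / 2)‖ ≤ (C * ‖s‖) ^ 3 := by
  have hb : ∀ᵐ x ∂ν, |⟪x, s⟫| ≤ C * ‖s‖ := by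
    filter_upwards [hC] with x hx
    exact (abs_real_inner_le_norm x s).trans (by gcongr)
  have hm : Continuous fun x : E => ⟪x, s⟫ := by fun_prop
  have i1 : Integrable (fun x => ⟪x, s⟫) ν :=
    Integrable.of_bound hm.aestronglyMeasurable (C * ‖s‖) (by simpa using hb)
  have i2 : Integrable (fun x => ⟪x, s⟫ ^ 2) ν := by
    refine Integrable.of_bound (hm.pow 2).aestronglyMeasurable ((C * ‖s‖) ^ 2) ?_
    filter_upwards [hb] with x hx
    rw [norm_pow, Real.norm_eq_abs]
    gcongr
  have i3 : Integrable (fun x => Complex.exp (⟪x, s⟫ * Complex.I)) ν := by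
    refine Integrable.of_bound (by fun_prop) 1 ?_
    filter_upwards with x
    rw [Complex.norm_exp_ofReal_mul_I]
  have e : 1 - ((∫ x, ⟪x, s⟫ ^ 2 ∂ν : ℝ) : ℂ) / 2
      = ∫ x, (1 + (⟪x, s⟫ : ℂ) * Complex.I - (⟪x, s⟫ : ℂ) ^ 2 / 2) ∂ν := by
    have j1 : Integrable (fun x => (⟪x, s⟫ : ℂ) * Complex.I) ν := i1.ofReal.mul_const _
    have j2 : Integrable (fun x => (⟪x, s⟫ : ℂ) ^ 2 / 2) ν := by
      have := i2.ofReal (𝕜 := ℂ)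
      push_cast at this
      exact this.div_const _
    have j3 : Integrable (fun x => 1 + (⟪x, s⟫ : ℂ) * Complex.I) ν := (integrable_const _).add j1
    rw [integral_sub j3 j2, integral_add (integrable_const _) j1, integral_mul_const,
      integral_complex_ofReal, hmean, integral_div]
    have : ∫ x, (⟪x, s⟫ : ℂ) ^ 2 ∂ν = ((∫ x, ⟪x, s⟫ ^ 2 ∂ν : ℝ) : ℂ) := by
      rw [← integral_complex_ofReal]
      simp
    rw [this]
    simp
  have i4 : Integrable (fun x => 1 + (⟪x, s⟫ : ℂ) * Complex.I - (⟪x, s⟫ : ℂ) ^ 2 / 2) ν := by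
    have := i2.ofReal (𝕜 := ℂ)
    push_cast at this
    exact ((integrable_const _).add (i1.ofReal.mul_const _)).sub (this.div_const _)
  rw [e, charFun_apply, ← integral_sub i3 i4]
  refine (norm_integral_le_of_norm_le_const (C := (C * ‖s‖) ^ 3) ?_).trans (by simp)
  filter_upwards [hb] with x hx
  refine (norm_exp_mul_I_sub_taylor_two_le (hx.trans hs)).trans ?_
  gcongr

/-- Convergence of the characteristic functions of normalized sums of i.i.d. centred variables whose
law varies with the sample size, under a uniform bound and convergence of the second moments. -/
theorem tendsto_charFun_inv_sqrt_smul_pow {ν : ℕ → Measure E} [∀ N, IsProbabilityMeasure (ν N)]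
    {C : ℝ} (hC : ∀ N, ∀ᵐ x ∂ν N, ‖x‖ ≤ C) (hmean : ∀ N, ∀ t : E, ∫ x, ⟪x, t⟫ ∂ν N = 0)
    {t : E} {q : ℝ} (hq : Tendsto (fun N => ∫ x, ⟪x, t⟫ ^ 2 ∂ν N) atTop (𝓝 q)) :
    Tendsto (fun N : ℕ => (charFun (ν N) ((√(N : ℝ))⁻¹ • t)) ^ N) atTop
      (𝓝 (Complex.exp (-(q : ℂ) / 2))) := by
  -- If `N a_N → a` then `(1 + a_N)^N → exp a`. The Taylor error enters multiplied by `N`, as `N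
  -- (C‖t‖/√N)³ = O(N^{-1/2})`.
  have key : Tendsto (fun N : ℕ => (N : ℂ) * (charFun (ν N) ((√(N : ℝ))⁻¹ • t) - 1)) atTop
      (𝓝 (-(q : ℂ) / 2)) := by
    have hlim : Tendsto (fun N : ℕ => C * ‖t‖ * (√(N : ℝ))⁻¹) atTop (𝓝 0) := by
      rw [← mul_zero (C * ‖t‖)]
      exact (tendsto_inv_atTop_zero.comp <| Real.tendsto_sqrt_atTop.comp
        tendsto_natCast_atTop_atTop).const_mul _
    have h1 : Tendsto (fun N => -((∫ x, ⟪x, t⟫ ^ 2 ∂ν N : ℝ) : ℂ) / 2) atTop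
        (𝓝 (-(q : ℂ) / 2)) :=
      ((Complex.continuous_ofReal.tendsto q).comp hq).neg.div_const 2
    have h2 : Tendsto (fun N : ℕ => (C * ‖t‖) ^ 3 * (√(N : ℝ))⁻¹) atTop (𝓝 0) := by
      rw [← mul_zero ((C * ‖t‖) ^ 3)]
      exact (tendsto_inv_atTop_zero.comp <| Real.tendsto_sqrt_atTop.comp
        tendsto_natCast_atTop_atTop).const_mul _
    have h3 : Tendsto (fun N : ℕ => (N : ℂ) * (charFun (ν N) ((√(N : ℝ))⁻¹ • t) - 1)
        - -((∫ x, ⟪x, t⟫ ^ 2 ∂ν N : ℝ) : ℂ) / 2) atTop (𝓝 0) := by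
      refine squeeze_zero_norm' ?_ h2
      filter_upwards [hlim.eventually (ge_mem_nhds zero_lt_one), eventually_gt_atTop 0]
        with N hN hpos
      have hN0 : (0 : ℝ) < N := by exact_mod_cast hpos
      have hs0 : 0 < √(N : ℝ) := Real.sqrt_pos.2 hN0
      have hsq : √(N : ℝ) ^ 2 = N := Real.sq_sqrt hN0.le
      have hns : C * ‖(√(N : ℝ))⁻¹ • t‖ = C * ‖t‖ * (√(N : ℝ))⁻¹ := by
        rw [norm_smul, Real.norm_of_nonneg (by positivity)]
        ring
      have h4 := norm_charFun_sub_taylor_two_le (hC N) (hmean N)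
        (s := (√(N : ℝ))⁻¹ • t) (by rw [hns]; exact hN)
      rw [hns] at h4
      have e1 : ∫ x, ⟪x, (√(N : ℝ))⁻¹ • t⟫ ^ 2 ∂ν N = (N : ℝ)⁻¹ * ∫ x, ⟪x, t⟫ ^ 2 ∂ν N := by
        simp_rw [inner_smul_right, mul_pow, inv_pow, hsq]
        rw [integral_const_mul]
      rw [e1] at h4
      have e2 : (N : ℂ) * (charFun (ν N) ((√(N : ℝ))⁻¹ • t) - 1)
          - -((∫ x, ⟪x, t⟫ ^ 2 ∂ν N : ℝ) : ℂ) / 2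
          = (N : ℂ) * (charFun (ν N) ((√(N : ℝ))⁻¹ • t)
            - (1 - (((N : ℝ)⁻¹ * ∫ x, ⟪x, t⟫ ^ 2 ∂ν N : ℝ) : ℂ) / 2)) := by
        have : (N : ℂ) ≠ 0 := by exact_mod_cast hpos.ne'
        push_cast
        field_simp
        ring
      rw [e2, norm_mul, Complex.norm_natCast]
      calc (N : ℝ) * _ ≤ N * (C * ‖t‖ * (√(N : ℝ))⁻¹) ^ 3 := by gcongr
        _ = _ := by
          have : (√(N : ℝ))⁻¹ ^ 2 * N = 1 := by
            rw [inv_pow, hsq, inv_mul_cancel₀ hN0.ne']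
          linear_combination (C * ‖t‖) ^ 3 * (√(N : ℝ))⁻¹ * this
    simpa using h3.add h1
  refine (Complex.tendsto_one_add_pow_exp_of_tendsto key).congr fun N => ?_
  congr 1
  ring

/-- Central limit theorem for row-wise i.i.d., uniformly bounded, centred random vectors. -/
theorem tendstoInDistribution_inv_sqrt_smul_sum {Ω : Type*} [MeasurableSpace Ω] {P : Measure Ω}
    [IsProbabilityMeasure P] {d : ℕ} {ν : ℕ → Measure (EuclideanSpace ℝ (Fin d))}
    [∀ N, IsProbabilityMeasure (ν N)] {Y : (N : ℕ) → Fin N → Ω → EuclideanSpace ℝ (Fin d)}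
    (hlaw : ∀ N i, HasLaw (Y N i) (ν N) P) (hindep : ∀ N, iIndepFun (Y N) P)
    {C : ℝ} (hC : ∀ N, ∀ᵐ x ∂ν N, ‖x‖ ≤ C)
    (hmean : ∀ N, ∀ t : EuclideanSpace ℝ (Fin d), ∫ x, ⟪x, t⟫ ∂ν N = 0)
    {S : Matrix (Fin d) (Fin d) ℝ} (hS : S.PosSemidef)
    (hq : ∀ t : EuclideanSpace ℝ (Fin d),
      Tendsto (fun N => ∫ x, ⟪x, t⟫ ^ 2 ∂ν N) atTop (𝓝 (t.ofLp ⬝ᵥ S.mulVec t.ofLp))) :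
    TendstoInDistribution (fun (N : ℕ) ω => (√(N : ℝ))⁻¹ • ∑ i, Y N i ω) atTop id (fun _ => P)
      (multivariateGaussian 0 S) where
  forall_aemeasurable N :=
    (Finset.aemeasurable_fun_sum Finset.univ
      fun i _ => (hlaw N i).aemeasurable).fun_const_smul (√(N : ℝ))⁻¹
  aemeasurable_limit := aemeasurable_id
  tendsto := by
    refine ProbabilityMeasure.tendsto_iff_tendsto_charFun.2 fun t => ?_
    have hm : ∀ N, AEMeasurable (fun ω => ∑ i, Y N i ω) P := fun N =>
      Finset.aemeasurable_fun_sum _ fun i _ => (hlaw N i).aemeasurable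
    have e : ∀ N : ℕ, charFun (P.map fun ω => (√(N : ℝ))⁻¹ • ∑ i, Y N i ω) t
        = (charFun (ν N) ((√(N : ℝ))⁻¹ • t)) ^ N := by
      intro N
      have : P.map (fun ω => (√(N : ℝ))⁻¹ • ∑ i, Y N i ω)
          = (P.map fun ω => ∑ i, Y N i ω).map (fun x => (√(N : ℝ))⁻¹ • x) := by
        rw [AEMeasurable.map_map_of_aemeasurable (by fun_prop) (hm N)]
        rfl
      rw [this, charFun_map_smul,
        (hindep N).charFun_map_fun_sum_eq_prod fun i => (hlaw N i).aemeasurable]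
      simp [fun i => (hlaw N i).map_eq]
    have h := tendsto_charFun_inv_sqrt_smul_pow hC hmean (hq t)
    simp only [ProbabilityMeasure.coe_mk, e, Measure.map_id, charFun_multivariateGaussian hS]
    convert! h using 2
    simp [neg_div]

end CentralLimit

/-! ### The randomized law and its moments -/

section RandomizedLaw

variable {d n : ℕ}

/-- The closed cube `[-ε, ε]^d`. -/
def closedCube (d : ℕ) (ε : ℝ) : Set (EuclideanSpace ℝ (Fin d)) := {l | ∀ j, |l j| ≤ ε}

theorem closedCube_eq_preimage (d : ℕ) (ε : ℝ) :
    closedCube d ε = (WithLp.ofLp : EuclideanSpace ℝ (Fin d) → Fin d → ℝ) ⁻¹'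
      Set.Icc (fun _ => -ε) (fun _ => ε) := by
  ext l
  simp only [closedCube, Set.mem_ofPred_eq, Set.mem_preimage, Set.mem_Icc, Pi.le_def, abs_le]
  exact forall_and

theorem isClosed_closedCube (d : ℕ) (ε : ℝ) : IsClosed (closedCube d ε) := by
  rw [closedCube_eq_preimage]
  exact isClosed_Icc.preimage (by fun_prop)

theorem volume_closedCube (d : ℕ) {ε : ℝ} (hε : 0 < ε) :
    volume (closedCube d ε) = ENNReal.ofReal ((2 * ε) ^ d) := by
  rw [closedCube_eq_preimage]
  refine ((EuclideanSpace.volume_preserving_symm_measurableEquiv_toLp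
    (Fin d)).measure_preimage measurableSet_Icc.nullMeasurableSet).trans ?_
  rw [Real.volume_Icc_pi]
  simp only [sub_neg_eq_add, ← two_mul, Finset.prod_const, Finset.card_univ, Fintype.card_fin]
  rw [ENNReal.ofReal_pow (by positivity)]

theorem isCompact_closedCube (d : ℕ) (ε : ℝ) : IsCompact (closedCube d ε) := by
  refine Metric.isCompact_of_isClosed_isBounded (isClosed_closedCube d ε) ?_
  rw [Metric.isBounded_iff_subset_closedBall 0]
  refine ⟨√(∑ _j : Fin d, ε ^ 2), fun l hl => ?_⟩
  rw [mem_closedBall_zero_iff, EuclideanSpace.norm_eq]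
  refine Real.sqrt_le_sqrt (Finset.sum_le_sum fun j _ => ?_)
  rw [Real.norm_eq_abs]
  exact pow_le_pow_left₀ (abs_nonneg _) (hl j) 2

theorem uniformCubeDensity_eq_indicator (d : ℕ) (ε : ℝ) :
    uniformCubeDensity d ε = (closedCube d ε).indicator fun _ => ((2 * ε) ^ d)⁻¹ := by
  ext l
  simp only [uniformCubeDensity, Set.indicator, closedCube, Set.mem_ofPred_eq]
  congr

theorem measurable_uniformCubeDensity (d : ℕ) (ε : ℝ) : Measurable (uniformCubeDensity d ε) := by
  rw [uniformCubeDensity_eq_indicator]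
  exact measurable_const.indicator (isClosed_closedCube d ε).measurableSet

theorem uniformCubeDensity_nonneg (d : ℕ) {ε : ℝ} (hε : 0 < ε) (l : EuclideanSpace ℝ (Fin d)) :
    0 ≤ uniformCubeDensity d ε l := by
  rw [uniformCubeDensity_eq_indicator]
  exact Set.indicator_nonneg (fun _ _ => by positivity) _

theorem lintegral_uniformCubeDensity (d : ℕ) {ε : ℝ} (hε : 0 < ε) :
    ∫⁻ l, ENNReal.ofReal (uniformCubeDensity d ε l) = 1 := by
  have : ∀ l, ENNReal.ofReal (uniformCubeDensity d ε l)
      = (closedCube d ε).indicator (fun _ => ENNReal.ofReal ((2 * ε) ^ d)⁻¹) l := by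
    intro l
    rw [uniformCubeDensity_eq_indicator]
    by_cases h : l ∈ closedCube d ε <;> simp [h]
  simp_rw [this]
  rw [lintegral_indicator_const (isClosed_closedCube d ε).measurableSet, volume_closedCube d hε,
    ← ENNReal.ofReal_mul (by positivity), inv_mul_cancel₀ (by positivity), ENNReal.ofReal_one]

variable {Ω : Type*} [MeasurableSpace Ω] {P : Measure Ω}
  {f : EuclideanSpace ℝ (Fin d) → EuclideanSpace ℝ (Fin n) → ℝ}

/-- A measurable family of probability densities with respect to Lebesgue measure. -/
structure IsDensityFamily (f : EuclideanSpace ℝ (Fin d) → EuclideanSpace ℝ (Fin n) → ℝ) :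
    Prop where
  measurable : Measurable (Function.uncurry f)
  nonneg : ∀ lam z, 0 ≤ f lam z
  lintegral_eq_one : ∀ lam, ∫⁻ z, ENNReal.ofReal (f lam z) = 1

theorem IsDensityFamily.measurable_apply (hf : IsDensityFamily f)
    (lam : EuclideanSpace ℝ (Fin d)) : Measurable (f lam) :=
  hf.measurable.comp measurable_prodMk_left

theorem IsDensityFamily.integrable (hf : IsDensityFamily f) (lam : EuclideanSpace ℝ (Fin d)) :
    Integrable (f lam) := by
  refine ⟨(hf.measurable_apply lam).aestronglyMeasurable, ?_⟩
  rw [hasFiniteIntegral_iff_ofReal (ae_of_all _ (hf.nonneg lam)), hf.lintegral_eq_one lam]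
  exact ENNReal.one_lt_top

theorem IsDensityFamily.integral_eq_one (hf : IsDensityFamily f)
    (lam : EuclideanSpace ℝ (Fin d)) : ∫ z, f lam z = 1 := by
  rw [integral_eq_lintegral_of_nonneg_ae (ae_of_all _ (hf.nonneg lam))
    (hf.measurable_apply lam).aestronglyMeasurable, hf.lintegral_eq_one lam, ENNReal.toReal_one]

/-- The normalization is inherited from the total mass of the law of `Zpar lam`. -/
theorem IsDensityFamily.of_hasLaw [IsProbabilityMeasure P]
    {Zpar : EuclideanSpace ℝ (Fin d) → Ω → EuclideanSpace ℝ (Fin n)}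
    (hf_meas : Measurable (Function.uncurry f)) (hf_nonneg : ∀ lam z, 0 ≤ f lam z)
    (hZpar : ∀ lam, HasLaw (Zpar lam)
      ((volume : Measure (EuclideanSpace ℝ (Fin n))).withDensity
        (fun z => ENNReal.ofReal (f lam z))) P) : IsDensityFamily f where
  measurable := hf_meas
  nonneg := hf_nonneg
  lintegral_eq_one lam := by
    have h : IsProbabilityMeasure (P.map (Zpar lam)) :=
      Measure.isProbabilityMeasure_map (hZpar lam).aemeasurable
    rw [(hZpar lam).map_eq] at h
    rw [← setLIntegral_univ, ← withDensity_apply _ MeasurableSet.univ]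
    exact h.measure_univ

/-- The mean of `ψ` under the density `f lam`. -/
noncomputable def densityMean (f : EuclideanSpace ℝ (Fin d) → EuclideanSpace ℝ (Fin n) → ℝ)
    (ψ : EuclideanSpace ℝ (Fin n) → ℝ) (lam : EuclideanSpace ℝ (Fin d)) : ℝ :=
  ∫ z, ψ z * f lam z

theorem IsDensityFamily.integral_comp_eq_densityMean (hf : IsDensityFamily f)
    {lam : EuclideanSpace ℝ (Fin d)} {X : Ω → EuclideanSpace ℝ (Fin n)}
    (hX : HasLaw X ((volume : Measure (EuclideanSpace ℝ (Fin n))).withDensity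
        (fun z => ENNReal.ofReal (f lam z))) P)
    {ψ : EuclideanSpace ℝ (Fin n) → ℝ} (hψ : AEStronglyMeasurable ψ) :
    ∫ ω, ψ (X ω) ∂P = densityMean f ψ lam := by
  have h := hX.integral_comp (hψ.mono_ac (withDensity_absolutelyContinuous _ _))
  simp only [Function.comp_def] at h
  rw [h, integral_withDensity_eq_integral_toReal_smul
    (hf.measurable_apply lam).ennreal_ofReal (ae_of_all _ fun _ => ENNReal.ofReal_lt_top)]
  simp only [ENNReal.toReal_ofReal (hf.nonneg lam _), smul_eq_mul, densityMean, mul_comm]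

theorem IsDensityFamily.integrable_mul (hf : IsDensityFamily f) (lam : EuclideanSpace ℝ (Fin d))
    {ψ : EuclideanSpace ℝ (Fin n) → ℝ} (hψ : AEStronglyMeasurable ψ) {B : ℝ}
    (hB : ∀ᵐ z, |ψ z| ≤ B) : Integrable fun z => ψ z * f lam z :=
  (hf.integrable lam).bdd_mul hψ hB

theorem IsDensityFamily.abs_densityMean_le (hf : IsDensityFamily f)
    (lam : EuclideanSpace ℝ (Fin d)) {ψ : EuclideanSpace ℝ (Fin n) → ℝ} {B : ℝ}
    (hB : ∀ᵐ z, |ψ z| ≤ B) : |densityMean f ψ lam| ≤ B := by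
  rw [densityMean, ← Real.norm_eq_abs]
  refine (norm_integral_le_of_norm_le ((hf.integrable lam).const_mul B) ?_).trans ?_
  · filter_upwards [hB] with z hz
    rw [norm_mul, Real.norm_of_nonneg (hf.nonneg lam z)]
    exact mul_le_mul_of_nonneg_right hz (hf.nonneg lam z)
  · rw [integral_const_mul, hf.integral_eq_one, mul_one]

theorem IsDensityFamily.aestronglyMeasurable_mul_prod (hf : IsDensityFamily f)
    {ψ : EuclideanSpace ℝ (Fin n) → ℝ} (hψ : AEStronglyMeasurable ψ) :
    AEStronglyMeasurable (fun q : EuclideanSpace ℝ (Fin d) × EuclideanSpace ℝ (Fin n) =>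
      ψ q.2 * f q.1 q.2) :=
  (hψ.comp_quasiMeasurePreserving Measure.quasiMeasurePreserving_snd).mul
    hf.measurable.aestronglyMeasurable

theorem IsDensityFamily.aestronglyMeasurable_densityMean (hf : IsDensityFamily f)
    {ψ : EuclideanSpace ℝ (Fin n) → ℝ} (hψ : AEStronglyMeasurable ψ) :
    AEStronglyMeasurable (densityMean f ψ) :=
  (hf.aestronglyMeasurable_mul_prod hψ).integral_prod_right'

theorem IsDensityFamily.measurable_randomizedLaw_density (hf : IsDensityFamily f)
    {ℓ : EuclideanSpace ℝ (Fin d) → ℝ} (hℓ : Measurable ℓ) (lam0 : EuclideanSpace ℝ (Fin d)) :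
    Measurable (fun q : EuclideanSpace ℝ (Fin d) × EuclideanSpace ℝ (Fin n) =>
      ENNReal.ofReal (ℓ (lam0 - q.1) * f q.1 q.2)) :=
  ((hℓ.comp (measurable_fst.const_sub lam0)).mul hf.measurable).ennreal_ofReal

theorem IsDensityFamily.isProbabilityMeasure_randomizedLaw (hf : IsDensityFamily f)
    (lam0 : EuclideanSpace ℝ (Fin d)) {h : ℝ} (hh : 0 < h) :
    IsProbabilityMeasure (randomizedLaw (uniformCubeDensity d h) f lam0) := by
  have hm := hf.measurable_randomizedLaw_density (measurable_uniformCubeDensity d h) lam0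
  refine ⟨?_⟩
  rw [randomizedLaw, withDensity_apply _ MeasurableSet.univ, Measure.restrict_univ,
    Measure.volume_eq_prod, lintegral_prod _ hm.aemeasurable]
  simp only [ENNReal.ofReal_mul (uniformCubeDensity_nonneg d hh _)]
  have : ∀ x, ∫⁻ z, ENNReal.ofReal (uniformCubeDensity d h (lam0 - x)) * ENNReal.ofReal (f x z)
      = ENNReal.ofReal (uniformCubeDensity d h (lam0 - x)) := by
    intro x
    rw [lintegral_const_mul _ (hf.measurable_apply x).ennreal_ofReal, hf.lintegral_eq_one, mul_one]
  simp_rw [this]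
  rw [lintegral_sub_left_eq_self (fun x => ENNReal.ofReal (uniformCubeDensity d h x)) lam0,
    lintegral_uniformCubeDensity d hh]

/-- The measurability and the bound of `φ` hold only up to Lebesgue null sets; this carries them
over to the law of the sample. -/
theorem randomizedLaw_absolutelyContinuous (ℓ : EuclideanSpace ℝ (Fin d) → ℝ)
    (f : EuclideanSpace ℝ (Fin d) → EuclideanSpace ℝ (Fin n) → ℝ)
    (lam0 : EuclideanSpace ℝ (Fin d)) :
    randomizedLaw ℓ f lam0 ≪ (volume : Measure (EuclideanSpace ℝ (Fin d))).prod volume :=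
  withDensity_absolutelyContinuous _ _

/-- Moments of the randomized law: rescaling the parameter by the bandwidth. -/
theorem IsDensityFamily.integral_randomizedLaw (hf : IsDensityFamily f)
    (lam0 : EuclideanSpace ℝ (Fin d)) {h : ℝ} (hh : 0 < h)
    {ψ : EuclideanSpace ℝ (Fin n) → ℝ} (hψ : AEStronglyMeasurable ψ) {B : ℝ}
    (hB : ∀ᵐ z, |ψ z| ≤ B) {k : EuclideanSpace ℝ (Fin d) → ℝ} (hk : Continuous k)
    (hsupp : Function.support k ⊆ closedCube d 1) {A : ℝ} (hA : ∀ l, |k l| ≤ A) :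
    ∫ q, ψ q.2 * k (h⁻¹ • (lam0 - q.1)) ∂(randomizedLaw (uniformCubeDensity d h) f lam0)
      = ((2 : ℝ) ^ d)⁻¹ * ∫ l, k l * densityMean f ψ (lam0 - h • l) := by
  have hm := hf.measurable_randomizedLaw_density (measurable_uniformCubeDensity d h) lam0
  have hprob := hf.isProbabilityMeasure_randomizedLaw lam0 hh
  have hψ2 : AEStronglyMeasurable
      (fun q : EuclideanSpace ℝ (Fin d) × EuclideanSpace ℝ (Fin n) => ψ q.2)
      (Measure.prod volume volume) :=
    hψ.comp_quasiMeasurePreserving Measure.quasiMeasurePreserving_snd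
  have hint : Integrable (fun q : EuclideanSpace ℝ (Fin d) × EuclideanSpace ℝ (Fin n) =>
      ψ q.2 * k (h⁻¹ • (lam0 - q.1))) (randomizedLaw (uniformCubeDensity d h) f lam0) := by
    refine Integrable.of_bound ((hψ2.mono_ac (randomizedLaw_absolutelyContinuous _ _ _)).mul
      (by fun_prop)) (B * A) ?_
    have hB2 : ∀ᵐ q ∂((volume : Measure (EuclideanSpace ℝ (Fin d))).prod
        (volume : Measure (EuclideanSpace ℝ (Fin n)))), |ψ q.2| ≤ B :=
      Measure.quasiMeasurePreserving_snd.ae hB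
    filter_upwards [(randomizedLaw_absolutelyContinuous _ _ _).ae_le hB2] with q hq
    rw [norm_mul, Real.norm_eq_abs, Real.norm_eq_abs]
    exact mul_le_mul hq (hA _) (abs_nonneg _) ((abs_nonneg _).trans hq)
  have hint2 := hint
  rw [randomizedLaw, integrable_withDensity_iff_integrable_smul' hm
    (ae_of_all _ fun _ => ENNReal.ofReal_lt_top)] at hint2
  rw [randomizedLaw, integral_withDensity_eq_integral_toReal_smul hm
    (ae_of_all _ fun _ => ENNReal.ofReal_lt_top)]
  have htr : ∀ q : EuclideanSpace ℝ (Fin d) × EuclideanSpace ℝ (Fin n),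
      (ENNReal.ofReal (uniformCubeDensity d h (lam0 - q.1) * f q.1 q.2)).toReal
        = uniformCubeDensity d h (lam0 - q.1) * f q.1 q.2 := fun q =>
    ENNReal.toReal_ofReal (mul_nonneg (uniformCubeDensity_nonneg d hh _) (hf.nonneg _ _))
  simp only [htr] at hint2 ⊢
  rw [Measure.volume_eq_prod] at hint2 ⊢
  rw [integral_prod _ hint2]
  let G : EuclideanSpace ℝ (Fin d) → ℝ := fun x =>
    uniformCubeDensity d h x * k (h⁻¹ • x) * densityMean f ψ (lam0 - x)
  have e1 : ∀ x : EuclideanSpace ℝ (Fin d),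
      ∫ z, (uniformCubeDensity d h (lam0 - x) * f x z) • (ψ z * k (h⁻¹ • (lam0 - x)))
        = G (lam0 - x) := by
    intro x
    simp only [G, sub_sub_cancel, densityMean]
    rw [← integral_const_mul]
    congr 1 with z
    simp only [smul_eq_mul]
    ring
  simp_rw [e1]
  rw [integral_sub_left_eq_self G volume lam0]
  have e2 := Measure.integral_comp_smul (volume : Measure (EuclideanSpace ℝ (Fin d))) G h
  -- On the unit cube the density takes its constant value, and off it `k` vanishes, so the
  -- indicator drops out. The factor `(h ^ d)⁻¹` matches the Jacobian in `e2`.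
  have e3 : ∀ l, G (h • l)
      = ((2 : ℝ) ^ d)⁻¹ * (h ^ d)⁻¹ * (k l * densityMean f ψ (lam0 - h • l)) := by
    intro l
    simp only [G, smul_smul, inv_mul_cancel₀ hh.ne', one_smul]
    by_cases hl : l ∈ closedCube d 1
    · have : h • l ∈ closedCube d h := fun j => by
        rw [PiLp.smul_apply, smul_eq_mul, abs_mul, abs_of_pos hh]
        exact mul_le_of_le_one_right hh.le (hl j)
      rw [uniformCubeDensity_eq_indicator, Set.indicator_of_mem this, mul_pow, mul_inv]
      ring
    · have : k l = 0 := by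
        by_contra h0
        exact hl (hsupp h0)
      simp [this]
  simp_rw [e3] at e2
  rw [integral_const_mul, finrank_euclideanSpace_fin, abs_of_pos (by positivity),
    smul_eq_mul] at e2
  have hd : (h ^ d)⁻¹ ≠ 0 := by positivity
  apply mul_left_cancel₀ hd
  rw [← e2]
  ring

end RandomizedLaw

/-! ### Continuity of means and kernel smoothing -/

section Smoothing

variable {d n : ℕ} {f : EuclideanSpace ℝ (Fin d) → EuclideanSpace ℝ (Fin n) → ℝ}

/-- Scheffé's lemma for a family of densities that is pointwise continuous in the parameter. -/
theorem IsDensityFamily.tendsto_integral_abs_sub (hf : IsDensityFamily f)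
    {lam0 : EuclideanSpace ℝ (Fin d)} (hc : ∀ z, ContinuousAt (fun lam => f lam z) lam0) :
    Tendsto (fun lam => ∫ z, |f lam0 z - f lam z|) (𝓝 lam0) (𝓝 0) := by
  -- Equal total masses make the positive and negative parts of the difference have the same
  -- integral. The positive part is dominated by `f lam0`, independently of `lam`.
  have e : ∀ lam, ∫ z, |f lam0 z - f lam z| = 2 * ∫ z, max (f lam0 z - f lam z) 0 := by
    intro lam
    have hi : Integrable fun z => f lam0 z - f lam z :=
      (hf.integrable lam0).sub (hf.integrable lam)
    have h0 : ∫ z, (f lam0 z - f lam z) = 0 := by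
      rw [integral_sub (hf.integrable lam0) (hf.integrable lam), hf.integral_eq_one,
        hf.integral_eq_one, sub_self]
    have h1 : ∀ z, |f lam0 z - f lam z|
        = 2 * max (f lam0 z - f lam z) 0 - (f lam0 z - f lam z) := by
      intro z
      rcases le_total 0 (f lam0 z - f lam z) with h | h
      · rw [abs_of_nonneg h, max_eq_left h]; ring
      · rw [abs_of_nonpos h, max_eq_right h]; ring
    simp_rw [h1]
    rw [integral_sub (hi.pos_part.const_mul 2) hi, h0, sub_zero, integral_const_mul]
  simp_rw [e]
  rw [← mul_zero (2 : ℝ)]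
  refine Tendsto.const_mul 2 ?_
  have hlim : Tendsto (fun lam => ∫ z, max (f lam0 z - f lam z) 0) (𝓝 lam0)
      (𝓝 (∫ _z : EuclideanSpace ℝ (Fin n), (0 : ℝ))) := by
    refine tendsto_integral_filter_of_dominated_convergence (f lam0) ?_ ?_ (hf.integrable lam0) ?_
    · exact Eventually.of_forall fun lam => (((hf.measurable_apply lam0).sub
        (hf.measurable_apply lam)).max measurable_const).aestronglyMeasurable
    · refine Eventually.of_forall fun lam => ae_of_all _ fun z => ?_
      rw [Real.norm_of_nonneg (le_max_right _ _)]
      exact max_le (sub_le_self _ (hf.nonneg lam z)) (hf.nonneg lam0 z)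
    · refine ae_of_all _ fun z => ?_
      have h := (((tendsto_const_nhds (x := f lam0 z)).sub (hc z).tendsto).max
        (tendsto_const_nhds (x := (0 : ℝ))))
      simpa using h
  simpa using hlim

/-- `L¹` continuity of the densities, paired with a bounded function. -/
theorem IsDensityFamily.continuousAt_densityMean (hf : IsDensityFamily f)
    {lam0 : EuclideanSpace ℝ (Fin d)} (hc : ∀ z, ContinuousAt (fun lam => f lam z) lam0)
    {ψ : EuclideanSpace ℝ (Fin n) → ℝ} (hψ : AEStronglyMeasurable ψ) {B : ℝ}
    (hB : ∀ᵐ z, |ψ z| ≤ B) : ContinuousAt (densityMean f ψ) lam0 := by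
  rw [ContinuousAt, tendsto_iff_norm_sub_tendsto_zero]
  have h2 : Tendsto (fun lam => B * ∫ z, |f lam0 z - f lam z|) (𝓝 lam0) (𝓝 0) := by
    simpa using (hf.tendsto_integral_abs_sub hc).const_mul B
  refine squeeze_zero (fun _ => norm_nonneg _) (fun lam => ?_) h2
  rw [densityMean, densityMean,
    ← integral_sub (hf.integrable_mul lam hψ hB) (hf.integrable_mul lam0 hψ hB),
    ← integral_const_mul]
  refine norm_integral_le_of_norm_le
    (((hf.integrable lam0).sub (hf.integrable lam)).abs.const_mul B) ?_
  filter_upwards [hB] with z hz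
  rw [← mul_sub, norm_mul, Real.norm_eq_abs, Real.norm_eq_abs, abs_sub_comm]
  exact mul_le_mul_of_nonneg_right hz (abs_nonneg _)

theorem hasCompactSupport_of_support_subset_closedCube {k : EuclideanSpace ℝ (Fin d) → ℝ}
    (hsupp : Function.support k ⊆ closedCube d 1) : HasCompactSupport k :=
  HasCompactSupport.of_support_subset_isCompact (isCompact_closedCube d 1) hsupp

theorem IsDensityFamily.tendsto_integral_mul_densityMean (hf : IsDensityFamily f)
    {lam0 : EuclideanSpace ℝ (Fin d)} (hc : ∀ z, ContinuousAt (fun lam => f lam z) lam0)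
    {ψ : EuclideanSpace ℝ (Fin n) → ℝ} (hψ : AEStronglyMeasurable ψ) {B : ℝ}
    (hB : ∀ᵐ z, |ψ z| ≤ B) {k : EuclideanSpace ℝ (Fin d) → ℝ} (hk : Integrable k)
    {h : ℕ → ℝ} (h_pos : ∀ N, 0 < h N) (h_lim : Tendsto h atTop (𝓝 0)) :
    Tendsto (fun N => ∫ l, k l * densityMean f ψ (lam0 - h N • l)) atTop
      (𝓝 ((∫ l, k l) * densityMean f ψ lam0)) := by
  rw [← integral_mul_const]
  refine tendsto_integral_of_dominated_convergence (fun l => |k l| * B) (fun N => ?_)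
    (hk.abs.mul_const B) (fun N => ae_of_all _ fun l => ?_) (ae_of_all _ fun l => ?_)
  -- The mean is available only as an a.e. strongly measurable function, so the substitution must
  -- pull null sets back to null sets.
  · have h1 : Measure.QuasiMeasurePreserving (fun l : EuclideanSpace ℝ (Fin d) => h N • l) :=
      ⟨by fun_prop, by
        rw [Measure.map_addHaar_smul _ (h_pos N).ne']
        exact Measure.smul_absolutelyContinuous⟩
    exact hk.aestronglyMeasurable.mul
      ((hf.aestronglyMeasurable_densityMean hψ).comp_quasiMeasurePreserving
        ((Measure.measurePreserving_sub_left volume lam0).quasiMeasurePreserving.comp h1))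
  · rw [norm_mul, Real.norm_eq_abs, Real.norm_eq_abs]
    exact mul_le_mul_of_nonneg_left (hf.abs_densityMean_le _ hB) (abs_nonneg _)
  · refine Tendsto.const_mul _ ((hf.continuousAt_densityMean hc hψ hB).tendsto.comp ?_)
    have := (tendsto_const_nhds (x := lam0)).sub (h_lim.smul_const l)
    simpa using this

theorem IsDensityFamily.tendsto_integral_randomizedLaw (hf : IsDensityFamily f)
    {lam0 : EuclideanSpace ℝ (Fin d)} (hc : ∀ z, ContinuousAt (fun lam => f lam z) lam0)
    {ψ : EuclideanSpace ℝ (Fin n) → ℝ} (hψ : AEStronglyMeasurable ψ) {B : ℝ}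
    (hB : ∀ᵐ z, |ψ z| ≤ B) {k : EuclideanSpace ℝ (Fin d) → ℝ} (hk : Continuous k)
    (hsupp : Function.support k ⊆ closedCube d 1)
    {h : ℕ → ℝ} (h_pos : ∀ N, 0 < h N) (h_lim : Tendsto h atTop (𝓝 0)) :
    Tendsto (fun N => ∫ q, ψ q.2 * k ((h N)⁻¹ • (lam0 - q.1))
        ∂(randomizedLaw (uniformCubeDensity d (h N)) f lam0)) atTop
      (𝓝 (((2 : ℝ) ^ d)⁻¹ * ((∫ l, k l) * densityMean f ψ lam0))) := by
  have hcs := hasCompactSupport_of_support_subset_closedCube hsupp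
  obtain ⟨A, hA⟩ := hcs.exists_bound_of_continuous hk
  simp_rw [fun N => hf.integral_randomizedLaw lam0 (h_pos N) hψ hB hk hsupp hA]
  exact (hf.tendsto_integral_mul_densityMean hc hψ hB (hk.integrable_of_hasCompactSupport hcs)
    h_pos h_lim).const_mul _

end Smoothing

/-! ### The gradient of the kernel -/

section Kernel

open scoped RealInnerProductSpace

variable {d p : ℕ} {K : EuclideanSpace ℝ (Fin d) → ℝ}

theorem gradient_coord (K : EuclideanSpace ℝ (Fin d) → ℝ) (l : EuclideanSpace ℝ (Fin d))
    (j : Fin d) : gradient K l j = fderiv ℝ K l (EuclideanSpace.single j 1) := by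
  rw [← inner_gradient_left, EuclideanSpace.inner_single_right]
  simp

theorem KernelAssumption.continuous_gradient (hK : KernelAssumption K p) :
    Continuous (gradient K) :=
  (InnerProductSpace.toDual ℝ _).symm.continuous.comp
    (hK.contDiff.continuous_fderiv one_ne_zero)

/-- The cube is closed, so it absorbs the closure of the support; the gradient then vanishes off the
cube. -/
theorem KernelAssumption.tsupport_subset (hK : KernelAssumption K p) :
    tsupport K ⊆ closedCube d 1 :=
  closure_minimal hK.support_subset (isClosed_closedCube d 1)

theorem KernelAssumption.gradient_eq_zero (hK : KernelAssumption K p)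
    {l : EuclideanSpace ℝ (Fin d)} (hl : l ∉ closedCube d 1) : gradient K l = 0 := by
  have : fderiv ℝ K l = 0 := by
    by_contra h
    exact hl (hK.tsupport_subset (support_fderiv_subset ℝ h))
  rw [gradient, this, map_zero]

theorem KernelAssumption.hasCompactSupport_gradient (hK : KernelAssumption K p) :
    HasCompactSupport (gradient K) :=
  HasCompactSupport.of_support_subset_isCompact (isCompact_closedCube d 1) fun _ hl => by
    by_contra h
    exact hl (hK.gradient_eq_zero h)

theorem KernelAssumption.exists_norm_gradient_le (hK : KernelAssumption K p) :
    ∃ A, ∀ l, ‖gradient K l‖ ≤ A :=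
  hK.hasCompactSupport_gradient.exists_bound_of_continuous hK.continuous_gradient

theorem KernelAssumption.continuous_inner_gradient (hK : KernelAssumption K p)
    (t : EuclideanSpace ℝ (Fin d)) : Continuous fun l => ⟪gradient K l, t⟫ :=
  hK.continuous_gradient.inner continuous_const

theorem KernelAssumption.support_inner_gradient (hK : KernelAssumption K p)
    (t : EuclideanSpace ℝ (Fin d)) :
    (Function.support fun l => ⟪gradient K l, t⟫) ⊆ closedCube d 1 := fun l hl => by
  by_contra h
  exact hl (by simp [hK.gradient_eq_zero h])

theorem KernelAssumption.continuous_gradient_coord (hK : KernelAssumption K p) (j : Fin d) :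
    Continuous fun l => gradient K l j :=
  (EuclideanSpace.proj j).continuous.comp hK.continuous_gradient

theorem KernelAssumption.support_gradient_coord (hK : KernelAssumption K p) (j : Fin d) :
    (Function.support fun l => gradient K l j) ⊆ closedCube d 1 := fun l hl => by
  by_contra h
  exact hl (by simp [hK.gradient_eq_zero h])

/-- The quadratic form of the asymptotic covariance matrix. -/
theorem KernelAssumption.dotProduct_asymptoticCovariance (hK : KernelAssumption K p) (m : ℝ)
    (t : Fin d → ℝ) :
    t ⬝ᵥ (asymptoticCovariance K m).mulVec t
      = (2 : ℝ) ^ d * m * ∫ l, ⟪gradient K l, WithLp.toLp 2 t⟫ ^ 2 := by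
  have hi : ∀ i j, Integrable fun l => gradient K l i * gradient K l j := fun i j =>
    ((hK.continuous_gradient_coord i).mul
      (hK.continuous_gradient_coord j)).integrable_of_hasCompactSupport
      (hasCompactSupport_of_support_subset_closedCube (hK.support_gradient_coord i)).mul_right
  have e : ∀ l, ⟪gradient K l, WithLp.toLp 2 t⟫ ^ 2
      = ∑ i, ∑ j, t i * (t j * (gradient K l i * gradient K l j)) := by
    intro l
    rw [PiLp.inner_apply, sq, Finset.sum_mul_sum]
    refine Finset.sum_congr rfl fun i _ => Finset.sum_congr rfl fun j _ => ?_
    simp only [RCLike.inner_apply, conj_trivial]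
    ring
  simp_rw [e]
  rw [integral_finsetSum _ fun i _ => integrable_finsetSum _ fun j _ =>
    ((hi i j).const_mul _).const_mul _, Finset.mul_sum, dotProduct]
  refine Finset.sum_congr rfl fun i _ => ?_
  rw [integral_finsetSum _ fun j _ => ((hi i j).const_mul _).const_mul _, Finset.mul_sum,
    Matrix.mulVec, dotProduct, Finset.mul_sum]
  refine Finset.sum_congr rfl fun j _ => ?_
  rw [integral_const_mul, integral_const_mul, asymptoticCovariance, Matrix.of_apply]
  ring

/-- The quadratic form is a nonnegative multiple of the integral of a square. The formula for the
Gaussian characteristic function requires this positivity. -/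
theorem KernelAssumption.posSemidef_asymptoticCovariance (hK : KernelAssumption K p) {m : ℝ}
    (hm : 0 ≤ m) : (asymptoticCovariance K m).PosSemidef := by
  refine Matrix.PosSemidef.of_dotProduct_mulVec_nonneg ?_ fun t => ?_
  · ext i j
    simp only [asymptoticCovariance, Matrix.conjTranspose_apply, Matrix.of_apply, star_trivial,
      mul_comm (gradient K _ i)]
  · rw [star_trivial, hK.dotProduct_asymptoticCovariance]
    exact mul_nonneg (by positivity) (integral_nonneg fun l => sq_nonneg _)

end Kernel

/-! ### Averages of polynomials -/

section Averaging

/-- Pointwise averages of functions in a finite-dimensional function space stay in that space. -/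
theorem integral_mem_of_finiteDimensional {X Z : Type*} [MeasurableSpace Z] {μ : Measure Z}
    (E : Submodule ℝ (X → ℝ)) [FiniteDimensional ℝ E] {q : Z → X → ℝ} (hq : ∀ z, q z ∈ E)
    (hint : ∀ x, Integrable (fun z => q z x) μ) : (fun x => ∫ z, q z x ∂μ) ∈ E := by
  let ev : X → (E →ₗ[ℝ] ℝ) := fun x => (LinearMap.proj x).comp E.subtype
  -- A function at which every evaluation vanishes is zero, so evaluations span the dual of `E`.
  -- Coordinate functionals are then finite combinations of evaluations and inherit integrability
  -- from `hint`.
  have hspan : Submodule.span ℝ (Set.range ev) = ⊤ := by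
    refine Submodule.span_eq_top_of_ne_zero fun g hg => ?_
    by_contra! h
    exact hg (Subtype.ext (funext fun x => h (ev x) ⟨x, rfl⟩))
  have hL : ∀ L : E →ₗ[ℝ] ℝ, Integrable (fun z => L ⟨q z, hq z⟩) μ := by
    intro L
    have hmem : L ∈ Submodule.span ℝ (Set.range ev) := hspan ▸ Submodule.mem_top
    induction hmem using Submodule.span_induction with
    | mem L h =>
      obtain ⟨x, rfl⟩ := h
      exact hint x
    | zero => exact integrable_zero _ _ _
    | add L M _ _ hL hM => exact hL.add hM
    | smul a L _ hL => exact hL.const_mul a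
  let b := Module.finBasis ℝ E
  have e : (fun x => ∫ z, q z x ∂μ)
      = ∑ i, (∫ z, b.coord i ⟨q z, hq z⟩ ∂μ) • (b i : X → ℝ) := by
    ext x
    rw [Finset.sum_apply]
    simp only [Pi.smul_apply, smul_eq_mul]
    simp_rw [← integral_mul_const]
    rw [← integral_finsetSum _ fun i _ => (hL (b.coord i)).mul_const _]
    refine integral_congr_ae (ae_of_all _ fun z => ?_)
    have h := congrArg (ev x) (b.sum_repr ⟨q z, hq z⟩)
    rw [map_sum] at h
    simp only [map_smul, smul_eq_mul] at h
    exact h.symm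
  rw [e]
  exact Submodule.sum_mem _ fun i _ => Submodule.smul_mem _ _ (b i).2

variable {d : ℕ}

/-- The monomial `u ↦ ∏ i, u (α i)`. -/
def coordMonomial {k : ℕ} (α : Fin k → Fin d) (u : EuclideanSpace ℝ (Fin d)) : ℝ :=
  ∏ i, u (α i)

theorem coordMonomial_smul {k : ℕ} (α : Fin k → Fin d) (a : ℝ) (u : EuclideanSpace ℝ (Fin d)) :
    coordMonomial α (a • u) = a ^ k * coordMonomial α u := by
  simp [coordMonomial, Finset.prod_mul_distrib]

/-- Expanding every argument in the standard basis yields one term per tuple, so the same monomial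
recurs for each ordering of its factors. -/
theorem ContinuousMultilinearMap.apply_const_eq_sum_coordMonomial {k : ℕ}
    (M : ContinuousMultilinearMap ℝ (fun _ : Fin k => EuclideanSpace ℝ (Fin d)) ℝ)
    (u : EuclideanSpace ℝ (Fin d)) :
    M (fun _ => u) = ∑ α : Fin k → Fin d,
      M (fun i => EuclideanSpace.single (α i) 1) * coordMonomial α u := by
  have hu : u = ∑ j, u j • EuclideanSpace.single j (1 : ℝ) := by
    have := (EuclideanSpace.basisFun (Fin d) ℝ).sum_repr u
    simpa using this.symm
  have h1 : M (fun _ => u) = M (fun _ : Fin k => ∑ j, u j • EuclideanSpace.single j (1 : ℝ)) := by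
    rw [← hu]
  rw [h1, M.map_sum]
  refine Finset.sum_congr rfl fun α _ => ?_
  rw [M.map_smul_univ, smul_eq_mul, mul_comm, coordMonomial]

/-- Coordinates for the polynomials of degree at most `m` in `d` variables. -/
abbrev MonomialIndex (d m : ℕ) : Type := Σ k : Fin (m + 1), Fin (k : ℕ) → Fin d

end Averaging

/-! ### Taylor expansion -/

section Taylor

/-- Taylor expansion of order `m`, with the remainder controlled by the oscillation of the `m`-th
derivative. -/
theorem abs_sub_taylor_le_of_hasDerivAt {m : ℕ} {g : ℕ → ℝ → ℝ}
    (hg : ∀ k < m, ∀ t, HasDerivAt (g k) (g (k + 1) t) t) {B : ℝ}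
    (hB : ∀ t ∈ Set.Icc (0 : ℝ) 1, |g m t - g m 0| ≤ B) :
    ∀ t ∈ Set.Icc (0 : ℝ) 1,
      |g 0 t - ∑ k ∈ Finset.range (m + 1), g k 0 * (t ^ k / (k.factorial : ℝ))| ≤ B := by
  induction m generalizing g with
  | zero => simpa using hB
  | succ m ih =>
    -- Applied to the shifted sequence, the induction hypothesis bounds the derivative of the
    -- remainder `R` by `B`. As `R 0 = 0`, the mean value inequality bounds `R`, with no continuity
    -- or integrability of the top derivative.
    have ih' := ih (g := fun k => g (k + 1)) (fun k hk t => hg (k + 1) (by omega) t) hB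
    have hB0 : 0 ≤ B := (abs_nonneg _).trans (hB 0 (by simp))
    let R : ℝ → ℝ := fun t =>
      g 0 t - ∑ k ∈ Finset.range (m + 1 + 1), g k 0 * (t ^ k / (k.factorial : ℝ))
    have hR0 : R 0 = 0 := by
      simp [R, Finset.sum_range_succ']
    have hR : ∀ t, HasDerivAt R (g 1 t - ∑ k ∈ Finset.range (m + 1),
        g (k + 1) 0 * (t ^ k / (k.factorial : ℝ))) t := by
      intro t
      refine (hg 0 (by omega) t).sub ?_
      have h1 : ∀ k ∈ Finset.range (m + 1), HasDerivAt
          (fun t : ℝ => g (k + 1) 0 * (t ^ (k + 1) / ((k + 1).factorial : ℝ)))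
          (g (k + 1) 0 * (t ^ k / (k.factorial : ℝ))) t := by
        intro k _
        refine HasDerivAt.const_mul _ ?_
        have h2 := (hasDerivAt_pow (k + 1) t).div_const ((k + 1).factorial : ℝ)
        convert! h2 using 1
        rw [Nat.factorial_succ]
        push_cast
        have : (k.factorial : ℝ) ≠ 0 := by positivity
        field_simp
      have h3 := (HasDerivAt.fun_sum h1).add_const (g 0 0 * ((1 : ℝ) / 1))
      convert! h3 using 2 with s
      rw [Finset.sum_range_succ']
      simp
    intro t ht
    have h := norm_image_sub_le_of_norm_deriv_le_segment' (f := R) (a := 0) (b := 1) (C := B)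
      (fun s _ => (hR s).hasDerivWithinAt) (fun s hs => ih' s ⟨hs.1, hs.2.le⟩) t ht
    rw [hR0, sub_zero, sub_zero] at h
    refine h.trans ?_
    exact mul_le_of_le_one_right hB0 ht.2

variable {d n : ℕ}

/-- Chain rule along a line, reducing the expansion to one variable. -/
theorem TimesDifferentiable.hasDerivAt_line {m : ℕ} {F : EuclideanSpace ℝ (Fin d) → ℝ}
    (hF : TimesDifferentiable m F) {k : ℕ} (hk : k < m) (x u : EuclideanSpace ℝ (Fin d)) (t : ℝ) :
    HasDerivAt (fun s : ℝ => iteratedFDeriv ℝ k F (x + s • u) (fun _ => u))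
      (iteratedFDeriv ℝ (k + 1) F (x + t • u) (fun _ => u)) t := by
  have hline : HasDerivAt (fun s : ℝ => x + s • u) u t := by
    simpa using ((hasDerivAt_id t).smul_const u).const_add x
  have h1 := ((hF k hk) (x + t • u)).hasFDerivAt.comp_hasDerivAt t hline
  have h2 := (ContinuousMultilinearMap.apply ℝ (fun _ : Fin k => EuclideanSpace ℝ (Fin d)) ℝ
    (fun _ => u)).hasFDerivAt.comp_hasDerivAt t h1
  rw [iteratedFDeriv_succ_apply_left]
  exact h2

/-- Each derivative along `u` is a pointwise limit of difference quotients of the previous one, with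
steps `1/(i+1)`. -/
theorem measurable_iteratedFDeriv_apply_const
    {f : EuclideanSpace ℝ (Fin d) → EuclideanSpace ℝ (Fin n) → ℝ} {m : ℕ}
    (hm : ∀ lam, Measurable (f lam)) (hF : ∀ z, TimesDifferentiable m fun lam => f lam z) {k : ℕ}
    (hk : k ≤ m) (x u : EuclideanSpace ℝ (Fin d)) :
    Measurable fun z => iteratedFDeriv ℝ k (fun lam => f lam z) x (fun _ => u) := by
  induction k generalizing x with
  | zero => simpa using hm x
  | succ k ih =>
    have hs : Tendsto (fun i : ℕ => ((i : ℝ) + 1)⁻¹) atTop (𝓝[≠] 0) := by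
      refine tendsto_nhdsWithin_iff.2 ⟨?_, Eventually.of_forall fun i => ?_⟩
      · simpa [one_div] using tendsto_one_div_add_atTop_nhds_zero_nat (𝕜 := ℝ)
      · have : (0 : ℝ) < (i : ℝ) + 1 := by positivity
        exact (inv_pos.2 this).ne'
    refine measurable_of_tendsto_metrizable (f := fun (i : ℕ) z => (((i : ℝ) + 1)⁻¹)⁻¹ •
      (iteratedFDeriv ℝ k (fun lam => f lam z) (x + ((i : ℝ) + 1)⁻¹ • u) (fun _ => u)
        - iteratedFDeriv ℝ k (fun lam => f lam z) x (fun _ => u))) (fun i => ?_) ?_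
    · exact ((ih (by omega) _).sub (ih (by omega) _)).const_mul _
    · rw [tendsto_pi_nhds]
      intro z
      have h := ((hF z).hasDerivAt_line (k := k) (by omega) x u 0).tendsto_slope_zero.comp hs
      simpa [Function.comp_def] using h

/-- Polynomial expansion of the mean around `lam0` when the oscillation of the `m`-th derivative,
weighted by `φ`, is dominated near `lam0`. -/
theorem IsDensityFamily.exists_densityMean_expansion
    {f : EuclideanSpace ℝ (Fin d) → EuclideanSpace ℝ (Fin n) → ℝ} (hf : IsDensityFamily f) {m : ℕ}
    (hF : ∀ z, TimesDifferentiable m fun lam => f lam z) {φ : EuclideanSpace ℝ (Fin n) → ℝ}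
    (hφ : AEStronglyMeasurable φ) {B : ℝ} (hB : ∀ᵐ z, |φ z| ≤ B)
    {lam0 : EuclideanSpace ℝ (Fin d)} {r : ℝ} {G : EuclideanSpace ℝ (Fin n) → ℝ}
    (hG : Integrable G)
    (hdom : ∀ᵐ z, ∀ lam ∈ Metric.ball lam0 r,
      |φ z| * ‖iteratedFDeriv ℝ m (fun l => f l z) lam
        - iteratedFDeriv ℝ m (fun l => f l z) lam0‖ ≤ G z) :
    ∃ (c : MonomialIndex d m → ℝ) (C : ℝ), ∀ u ∈ Metric.ball (0 : EuclideanSpace ℝ (Fin d)) r,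
      |densityMean f φ (lam0 + u) - ∑ s, c s * coordMonomial s.2 u| ≤ C * ‖u‖ ^ m := by
  let D : ℕ → EuclideanSpace ℝ (Fin n) → EuclideanSpace ℝ (Fin d) → EuclideanSpace ℝ (Fin d) → ℝ :=
    fun k z x u => iteratedFDeriv ℝ k (fun l => f l z) x (fun _ => u)
  let q : EuclideanSpace ℝ (Fin n) → EuclideanSpace ℝ (Fin d) → ℝ := fun z u =>
    ∑ k ∈ Finset.range (m + 1), φ z * D k z lam0 u * (1 / (k.factorial : ℝ))
  have hrem : ∀ u ∈ Metric.ball (0 : EuclideanSpace ℝ (Fin d)) r, ∀ᵐ z,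
      |φ z * f (lam0 + u) z - q z u| ≤ G z * ‖u‖ ^ m := by
    intro u hu
    filter_upwards [hdom] with z hz
    have h := abs_sub_taylor_le_of_hasDerivAt (m := m)
      (g := fun k t => φ z * D k z (lam0 + t • u) u) (B := G z * ‖u‖ ^ m)
      (fun k hk t => ((hF z).hasDerivAt_line hk lam0 u t).const_mul _) (fun t ht => ?_) 1 (by simp)
    · simpa [q, D] using h
    · have hmem : lam0 + t • u ∈ Metric.ball lam0 r := by
        rw [mem_ball_zero_iff] at hu
        rw [Metric.mem_ball, dist_eq_norm, add_sub_cancel_left, norm_smul,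
          Real.norm_of_nonneg ht.1]
        exact (mul_le_of_le_one_left (norm_nonneg u) ht.2).trans_lt hu
      have h1 := hz _ hmem
      have h2 := (iteratedFDeriv ℝ m (fun l => f l z) (lam0 + t • u)
        - iteratedFDeriv ℝ m (fun l => f l z) lam0).le_opNorm (fun _ => u)
      simp only [zero_smul, add_zero, D]
      rw [← mul_sub, abs_mul]
      rw [Finset.prod_const, Finset.card_univ, Fintype.card_fin,
        sub_apply, Real.norm_eq_abs] at h2
      calc _ ≤ |φ z| * (‖iteratedFDeriv ℝ m (fun l => f l z) (lam0 + t • u)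
            - iteratedFDeriv ℝ m (fun l => f l z) lam0‖ * ‖u‖ ^ m) := by gcongr
        _ ≤ G z * ‖u‖ ^ m := by
          rw [← mul_assoc]
          gcongr
  have hqm : ∀ u, AEStronglyMeasurable (fun z => q z u) := fun u =>
    Finset.aestronglyMeasurable_fun_sum _ fun k hk => (hφ.mul
      (measurable_iteratedFDeriv_apply_const hf.measurable_apply hF
        (Nat.lt_succ_iff.1 (Finset.mem_range.1 hk)) lam0 u).aestronglyMeasurable).mul_const _
  have hfi := fun lam => hf.integrable_mul lam hφ hB
  have hRi : ∀ u ∈ Metric.ball (0 : EuclideanSpace ℝ (Fin d)) r,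
      Integrable fun z => φ z * f (lam0 + u) z - q z u := fun u hu =>
    (hG.mul_const (‖u‖ ^ m)).mono' ((hfi _).aestronglyMeasurable.sub (hqm u)) (hrem u hu)
  -- Integrability of the whole polynomial at `u`, as an integrable function minus a dominated
  -- remainder; nothing is claimed about separate coefficients.
  have hqi : ∀ u ∈ Metric.ball (0 : EuclideanSpace ℝ (Fin d)) r, Integrable fun z => q z u := by
    intro u hu
    have := (hfi (lam0 + u)).sub (hRi u hu)
    refine this.congr (ae_of_all _ fun z => ?_)
    simp
  -- Monomials are restricted to the ball because `q` is known to be integrable only there.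
  let v : MonomialIndex d m → Metric.ball (0 : EuclideanSpace ℝ (Fin d)) r → ℝ :=
    fun s u => coordMonomial s.2 u.1
  have hfin : FiniteDimensional ℝ (Submodule.span ℝ (Set.range v)) :=
    FiniteDimensional.span_of_finite ℝ (Set.finite_range v)
  have hmem := integral_mem_of_finiteDimensional (μ := volume)
    (Submodule.span ℝ (Set.range v))
    (q := fun z (u : Metric.ball (0 : EuclideanSpace ℝ (Fin d)) r) => q z u.1) (fun z => ?_)
    (fun u => hqi u.1 u.2)
  · obtain ⟨c, hc⟩ := (Submodule.mem_span_range_iff_exists_fun ℝ).1 hmem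
    refine ⟨c, ∫ z, G z, fun u hu => ?_⟩
    have h1 := congrFun hc ⟨u, hu⟩
    rw [Finset.sum_apply] at h1
    simp only [Pi.smul_apply, smul_eq_mul, v] at h1
    rw [h1, densityMean, ← integral_sub (hfi _) (hqi u hu), ← integral_mul_const]
    rw [← Real.norm_eq_abs]
    exact norm_integral_le_of_norm_le (hG.mul_const _) (hrem u hu)
  · rw [Submodule.mem_span_range_iff_exists_fun]
    refine ⟨fun s => φ z * iteratedFDeriv ℝ (s.1 : ℕ) (fun l => f l z) lam0
      (fun i => EuclideanSpace.single (s.2 i) 1) * (1 / ((s.1 : ℕ).factorial : ℝ)), ?_⟩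
    ext u
    rw [Finset.sum_apply, Fintype.sum_sigma]
    simp only [Pi.smul_apply, smul_eq_mul, v, q, D]
    rw [Finset.sum_range]
    refine Finset.sum_congr rfl fun k _ => ?_
    rw [ContinuousMultilinearMap.apply_const_eq_sum_coordMonomial, Finset.mul_sum, Finset.sum_mul]
    refine Finset.sum_congr rfl fun α _ => ?_
    ring

end Taylor

/-! ### Bias of the kernel derivative -/

section Bias

open scoped RealInnerProductSpace

variable {d n p : ℕ} {K : EuclideanSpace ℝ (Fin d) → ℝ}

theorem continuous_coordMonomial {k : ℕ} (α : Fin k → Fin d) : Continuous (coordMonomial α) :=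
  continuous_finsetProd _ fun i _ => (EuclideanSpace.proj (α i)).continuous

theorem hasFDerivAt_coordMonomial {k : ℕ} (α : Fin k → Fin d) (u : EuclideanSpace ℝ (Fin d)) :
    HasFDerivAt (coordMonomial α)
      (∑ i, (∏ i' ∈ Finset.univ.erase i, u (α i')) •
        (EuclideanSpace.proj (α i) : EuclideanSpace ℝ (Fin d) →L[ℝ] ℝ)) u :=
  HasFDerivAt.finsetProd (u := Finset.univ) (g := fun i (l : EuclideanSpace ℝ (Fin d)) => l (α i))
    fun i _ => (EuclideanSpace.proj (α i) : EuclideanSpace ℝ (Fin d) →L[ℝ] ℝ).hasFDerivAt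

/-- Product rule: the `i`-th term loses the factor `α i`, and `i.succAbove` enumerates the others.
-/
theorem fderiv_coordMonomial_single {k : ℕ} (α : Fin (k + 1) → Fin d)
    (u : EuclideanSpace ℝ (Fin d)) (j : Fin d) :
    fderiv ℝ (coordMonomial α) u (EuclideanSpace.single j 1)
      = ∑ i, coordMonomial (α ∘ i.succAbove) u * if α i = j then 1 else 0 := by
  rw [(hasFDerivAt_coordMonomial α u).fderiv, sum_apply]
  refine Finset.sum_congr rfl fun i _ => ?_
  have h : ∏ i' ∈ Finset.univ.erase i, u (α i') = coordMonomial (α ∘ i.succAbove) u := by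
    rw [← Finset.compl_singleton, coordMonomial, ← Fin.image_succAbove_univ,
      Finset.prod_image fun _ _ _ _ h => Fin.succAbove_right_injective h]
    rfl
  rw [h]
  simp

theorem KernelAssumption.hasCompactSupport (hK : KernelAssumption K p) : HasCompactSupport K :=
  hasCompactSupport_of_support_subset_closedCube hK.support_subset

theorem KernelAssumption.hasCompactSupport_gradient_coord (hK : KernelAssumption K p)
    (j : Fin d) : HasCompactSupport fun l => gradient K l j :=
  hasCompactSupport_of_support_subset_closedCube (hK.support_gradient_coord j)

/-- Integration by parts; the compact support of `K` removes any growth condition on `q`. -/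
theorem KernelAssumption.integral_gradient_mul (hK : KernelAssumption K p) (j : Fin d)
    {q : EuclideanSpace ℝ (Fin d) → ℝ} (hq : Differentiable ℝ q)
    (hq' : Continuous fun l => fderiv ℝ q l (EuclideanSpace.single j 1)) :
    ∫ l, gradient K l j * q l = -∫ l, fderiv ℝ q l (EuclideanSpace.single j 1) * K l := by
  have hKc := hK.contDiff.continuous
  have hg := hK.continuous_gradient_coord j
  have h := integral_mul_fderiv_eq_neg_fderiv_mul_of_integrable
    (μ := (volume : Measure (EuclideanSpace ℝ (Fin d)))) (f := q) (g := K)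
    (v := EuclideanSpace.single j 1)
    ((hq'.mul hKc).integrable_of_hasCompactSupport hK.hasCompactSupport.mul_left)
    (by
      simp_rw [← gradient_coord]
      exact (hq.continuous.mul hg).integrable_of_hasCompactSupport
        (hK.hasCompactSupport_gradient_coord j).mul_left)
    ((hq.continuous.mul hKc).integrable_of_hasCompactSupport hK.hasCompactSupport.mul_left)
    (fun x _ => hq x) (fun x _ => hK.contDiff.differentiable one_ne_zero x)
  rw [← h]
  simp_rw [gradient_coord, mul_comm]

theorem differentiable_coordMonomial {k : ℕ} (α : Fin k → Fin d) :
    Differentiable ℝ (coordMonomial α) :=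
  fun u => (hasFDerivAt_coordMonomial α u).differentiableAt

theorem KernelAssumption.integral_gradient_mul_const (hK : KernelAssumption K p) (j : Fin d)
    (α : Fin 0 → Fin d) : ∫ l, gradient K l j * coordMonomial α l = 0 := by
  have h : coordMonomial α = fun _ => 1 := by ext; simp [coordMonomial]
  rw [h, hK.integral_gradient_mul j (differentiable_const _) (by simp [continuous_const])]
  simp

theorem KernelAssumption.integral_gradient_mul_succ (hK : KernelAssumption K p) (j : Fin d)
    {k : ℕ} (α : Fin (k + 1) → Fin d) :
    ∫ l, gradient K l j * coordMonomial α l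
      = -∑ i, (∫ l, coordMonomial (α ∘ i.succAbove) l * K l) * if α i = j then 1 else 0 := by
  have hi : ∀ i : Fin (k + 1), Integrable fun l => coordMonomial (α ∘ i.succAbove) l * K l :=
    fun i => ((continuous_coordMonomial _).mul
      hK.contDiff.continuous).integrable_of_hasCompactSupport hK.hasCompactSupport.mul_left
  rw [hK.integral_gradient_mul j (differentiable_coordMonomial α)]
  · congr 1
    simp_rw [fderiv_coordMonomial_single, Finset.sum_mul, mul_right_comm]
    rw [integral_finsetSum _ fun i _ => (hi i).mul_const _]
    simp_rw [integral_mul_const]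
  · simp_rw [fderiv_coordMonomial_single]
    exact continuous_finsetSum _ fun i _ => (continuous_coordMonomial _).mul continuous_const

theorem KernelAssumption.integral_gradient_mul_linear (hK : KernelAssumption K p) (j : Fin d)
    (α : Fin 1 → Fin d) :
    ∫ l, gradient K l j * coordMonomial α l = -if α 0 = j then 1 else 0 := by
  rw [hK.integral_gradient_mul_succ, Fin.sum_univ_one]
  simp [coordMonomial, hK.integral_eq_one]

/-- Differentiation leaves degree `k + 1`, strictly between `0` and `p`, where the moments of `K`
vanish. -/
theorem KernelAssumption.integral_gradient_mul_eq_zero (hK : KernelAssumption K p) (j : Fin d)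
    {k : ℕ} (hk : k + 2 ≤ p) (α : Fin (k + 2) → Fin d) :
    ∫ l, gradient K l j * coordMonomial α l = 0 := by
  rw [hK.integral_gradient_mul_succ, neg_eq_zero]
  refine Finset.sum_eq_zero fun i _ => ?_
  have := hK.order.2.1 (k + 1) (by omega) (by omega) (α ∘ i.succAbove)
  rw [show ∫ l, coordMonomial (α ∘ i.succAbove) l * K l = 0 from this, zero_mul]

/-- The index of the linear monomial `u ↦ u j`. -/
def linearIndex (p : ℕ) (j : Fin d) : MonomialIndex d (p + 1) := ⟨⟨1, by omega⟩, fun _ => j⟩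

/-- Contribution of one monomial: only the linear one matters below degree `p + 1`. -/
theorem KernelAssumption.abs_moment_sub_le (hK : KernelAssumption K p) (j : Fin d) {h : ℝ}
    (hh : 0 ≤ h) (s : MonomialIndex d (p + 1)) :
    |(-h) ^ (s.1 : ℕ) * (∫ l, gradient K l j * coordMonomial s.2 l)
        - (if s = linearIndex p j then h else 0)|
      ≤ h ^ (p + 1) * |∫ l, gradient K l j * coordMonomial s.2 l| := by
  have hp := hK.two_le
  obtain ⟨⟨k, hk⟩, α⟩ := s
  match k, hk, α with
  | 0, hk, α =>
    have hne : (⟨⟨0, hk⟩, α⟩ : MonomialIndex d (p + 1)) ≠ linearIndex p j := by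
      intro h
      simpa [linearIndex] using congrArg (fun s => (s.1 : ℕ)) h
    rw [if_neg hne]
    simp [hK.integral_gradient_mul_const j α]
  | 1, hk, α =>
    have hI := hK.integral_gradient_mul_linear j α
    by_cases hα : α 0 = j
    · have he : (⟨⟨1, hk⟩, α⟩ : MonomialIndex d (p + 1)) = linearIndex p j := by
        have : α = fun _ => j := by
          ext i
          rw [Subsingleton.elim i 0, hα]
        rw [this]
        rfl
      -- The minus sign from integration by parts cancels the one in `-h`.
      rw [if_pos he, hI, if_pos hα]
      simp only [pow_one, mul_neg, mul_one, neg_neg, sub_self, abs_zero]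
      positivity
    · have hne : (⟨⟨1, hk⟩, α⟩ : MonomialIndex d (p + 1)) ≠ linearIndex p j := by
        intro h
        apply hα
        simp only [linearIndex, Sigma.mk.injEq, heq_eq_eq, true_and] at h
        rw [h]
      rw [if_neg hne, hI, if_neg hα]
      simp
  | k + 2, hk, α =>
    have hne : (⟨⟨k + 2, hk⟩, α⟩ : MonomialIndex d (p + 1)) ≠ linearIndex p j := by
      intro h
      simpa [linearIndex] using congrArg (fun s => (s.1 : ℕ)) h
    rw [if_neg hne, sub_zero]
    by_cases hkp : k + 2 ≤ p
    · simp [hK.integral_gradient_mul_eq_zero j hkp α]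
    -- In degree `p + 1` the order of the kernel gives no cancellation; the bound is then an
    -- equality.
    · have : k + 2 = p + 1 := by omega
      rw [abs_mul, abs_pow, abs_neg, abs_of_nonneg hh]
      simp only [this, le_refl]

/-- The kernel derivative estimates the linear coefficient of a polynomial expansion of order
`p + 1`, up to an error of order `h ^ p`. -/
theorem KernelAssumption.exists_bias_bound (hK : KernelAssumption K p)
    {V : EuclideanSpace ℝ (Fin d) → ℝ} {lam0 : EuclideanSpace ℝ (Fin d)}
    (hV : AEStronglyMeasurable V) {r : ℝ} (hr : 0 < r)
    {c : MonomialIndex d (p + 1) → ℝ} {C : ℝ}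
    (hc : ∀ u ∈ Metric.ball (0 : EuclideanSpace ℝ (Fin d)) r,
      |V (lam0 + u) - ∑ s, c s * coordMonomial s.2 u| ≤ C * ‖u‖ ^ (p + 1)) (j : Fin d) :
    ∃ A : ℝ, ∃ δ > 0, ∀ h, 0 < h → h < δ →
      |h⁻¹ * (∫ l, gradient K l j * V (lam0 - h • l)) - c (linearIndex p j)| ≤ A * h ^ p := by
  obtain ⟨R, hRpos, hR⟩ := (isCompact_closedCube d 1).isBounded.subset_closedBall_lt 0 0
  have hg := hK.continuous_gradient_coord j
  have hgs := hK.hasCompactSupport_gradient_coord j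
  have hgi : Integrable fun l => gradient K l j := hg.integrable_of_hasCompactSupport hgs
  -- The first term pays for the remainder of the expansion, the second for the monomials of degree
  -- `p + 1`. Taking `h < r / R` keeps `h • l` within radius `r` for `l` in the cube.
  refine ⟨|C| * R ^ (p + 1) * (∫ l, |gradient K l j|)
    + ∑ s, |c s| * |∫ l, gradient K l j * coordMonomial s.2 l|, r / R, by positivity, ?_⟩
  intro h hh hδ
  let Q : EuclideanSpace ℝ (Fin d) → ℝ := fun u => ∑ s, c s * coordMonomial s.2 u
  have hQc : Continuous Q :=
    continuous_finsetSum _ fun s _ => continuous_const.mul (continuous_coordMonomial _)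
  have hbound : ∀ l, |gradient K l j * (V (lam0 - h • l) - Q (-(h • l)))|
      ≤ |gradient K l j| * (|C| * R ^ (p + 1) * h ^ (p + 1)) := by
    intro l
    by_cases hl : l ∈ closedCube d 1
    · have hlR : ‖l‖ ≤ R := by simpa using hR hl
      have hn : ‖-(h • l)‖ ≤ h * R := by
        rw [norm_neg, norm_smul, Real.norm_of_nonneg hh.le]
        gcongr
      have hball : -(h • l) ∈ Metric.ball (0 : EuclideanSpace ℝ (Fin d)) r := by
        rw [mem_ball_zero_iff]
        exact hn.trans_lt ((lt_div_iff₀ hRpos).1 hδ)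
      rw [abs_mul, sub_eq_add_neg]
      refine mul_le_mul_of_nonneg_left ((hc _ hball).trans ?_) (abs_nonneg _)
      calc C * ‖-(h • l)‖ ^ (p + 1) ≤ |C| * (h * R) ^ (p + 1) := by
            gcongr
            exact le_abs_self C
        _ = _ := by rw [mul_pow]; ring
    · rw [hK.gradient_eq_zero hl]
      simp
  have hVm : AEStronglyMeasurable fun l => V (lam0 - h • l) := by
    have h1 : Measure.QuasiMeasurePreserving (fun l : EuclideanSpace ℝ (Fin d) => h • l) :=
      ⟨by fun_prop, by
        rw [Measure.map_addHaar_smul _ hh.ne']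
        exact Measure.smul_absolutelyContinuous⟩
    exact hV.comp_quasiMeasurePreserving
      ((Measure.measurePreserving_sub_left volume lam0).quasiMeasurePreserving.comp h1)
  have hQh : Continuous fun l : EuclideanSpace ℝ (Fin d) => Q (-(h • l)) := by fun_prop
  have hdi : Integrable fun l => gradient K l j * (V (lam0 - h • l) - Q (-(h • l))) :=
    (hgi.abs.mul_const _).mono'
      (hg.aestronglyMeasurable.mul (hVm.sub hQh.aestronglyMeasurable)) (ae_of_all _ hbound)
  have hqi : Integrable fun l => gradient K l j * Q (-(h • l)) :=
    (hg.mul hQh).integrable_of_hasCompactSupport hgs.mul_right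
  have hsplit : ∫ l, gradient K l j * V (lam0 - h • l)
      = (∫ l, gradient K l j * (V (lam0 - h • l) - Q (-(h • l))))
        + ∫ l, gradient K l j * Q (-(h • l)) := by
    rw [← integral_add hdi hqi]
    congr 1 with l
    ring
  have hrem : |∫ l, gradient K l j * (V (lam0 - h • l) - Q (-(h • l)))|
      ≤ |C| * R ^ (p + 1) * (∫ l, |gradient K l j|) * h ^ (p + 1) := by
    rw [← Real.norm_eq_abs]
    refine (norm_integral_le_of_norm_le (hgi.abs.mul_const _) (ae_of_all _ hbound)).trans ?_
    rw [integral_mul_const]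
    exact le_of_eq (by ring)
  have hpoly : ∫ l, gradient K l j * Q (-(h • l))
      = ∑ s, c s * ((-h) ^ (s.1 : ℕ) * ∫ l, gradient K l j * coordMonomial s.2 l) := by
    have e : ∀ l, gradient K l j * Q (-(h • l))
        = ∑ s, c s * ((-h) ^ (s.1 : ℕ) * (gradient K l j * coordMonomial s.2 l)) := by
      intro l
      simp only [Q, ← neg_smul, coordMonomial_smul, Finset.mul_sum]
      refine Finset.sum_congr rfl fun s _ => ?_
      ring
    simp_rw [e]
    rw [integral_finsetSum]
    · simp_rw [integral_const_mul]
    · intro s _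
      exact (((hg.mul (continuous_coordMonomial _)).integrable_of_hasCompactSupport
        hgs.mul_right).const_mul _).const_mul _
  have hlin : h * c (linearIndex p j) = ∑ s, c s * if s = linearIndex p j then h else 0 := by
    simp [mul_comm]
  have hmain : |(∫ l, gradient K l j * Q (-(h • l))) - h * c (linearIndex p j)|
      ≤ (∑ s, |c s| * |∫ l, gradient K l j * coordMonomial s.2 l|) * h ^ (p + 1) := by
    rw [hpoly, hlin, ← Finset.sum_sub_distrib, Finset.sum_mul]
    refine (Finset.abs_sum_le_sum_abs _ _).trans (Finset.sum_le_sum fun s _ => ?_)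
    rw [← mul_sub, abs_mul, mul_assoc]
    refine mul_le_mul_of_nonneg_left ?_ (abs_nonneg _)
    rw [mul_comm |∫ l, _|]
    exact hK.abs_moment_sub_le j hh.le s
  have hfin : h⁻¹ * (∫ l, gradient K l j * V (lam0 - h • l)) - c (linearIndex p j)
      = h⁻¹ * ((∫ l, gradient K l j * (V (lam0 - h • l) - Q (-(h • l))))
        + ((∫ l, gradient K l j * Q (-(h • l))) - h * c (linearIndex p j))) := by
    rw [hsplit]
    field_simp
    ring
  rw [hfin, abs_mul, abs_of_pos (inv_pos.2 hh), inv_mul_le_iff₀ hh]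
  refine (abs_add_le _ _).trans ((add_le_add hrem hmain).trans (le_of_eq ?_))
  ring

/-- A polynomial expansion of order at least two gives the derivative. -/
theorem hasFDerivAt_of_coordMonomial_expansion {m : ℕ} (hm : 1 < m)
    {V : EuclideanSpace ℝ (Fin d) → ℝ} {lam0 : EuclideanSpace ℝ (Fin d)} {r : ℝ} (hr : 0 < r)
    {c : MonomialIndex d m → ℝ} {C : ℝ}
    (hc : ∀ u ∈ Metric.ball (0 : EuclideanSpace ℝ (Fin d)) r,
      |V (lam0 + u) - ∑ s, c s * coordMonomial s.2 u| ≤ C * ‖u‖ ^ m) :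
    HasFDerivAt V (fderiv ℝ (fun u => ∑ s, c s * coordMonomial s.2 u) 0) lam0 := by
  let Q : EuclideanSpace ℝ (Fin d) → ℝ := fun u => ∑ s, c s * coordMonomial s.2 u
  have hQ : DifferentiableAt ℝ Q 0 :=
    DifferentiableAt.fun_sum (𝕜 := ℝ) fun s _ => (differentiable_coordMonomial s.2 0).const_mul _
  have hR : HasFDerivAt (fun u => V (lam0 + u) - Q u)
      (0 : EuclideanSpace ℝ (Fin d) →L[ℝ] ℝ) 0 := by
    refine Asymptotics.IsBigO.hasFDerivAt (𝕜 := ℝ) (n := m) ?_ hm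
    refine Asymptotics.IsBigO.of_bound C ?_
    filter_upwards [Metric.ball_mem_nhds 0 hr] with u hu
    simpa using hc u hu
  have h1 := hR.add hQ.hasFDerivAt
  have h2 : HasFDerivAt (fun u => V (lam0 + u)) (fderiv ℝ Q 0) (0 : EuclideanSpace ℝ (Fin d)) := by
    convert! h1 using 1
    · ext u
      simp
    · rw [zero_add]
  have h3 : HasFDerivAt (fun x : EuclideanSpace ℝ (Fin d) => x - lam0)
      (ContinuousLinearMap.id ℝ (EuclideanSpace ℝ (Fin d))) lam0 :=
    (hasFDerivAt_id lam0).sub_const lam0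
  have h4 := HasFDerivAt.comp (g := fun u => V (lam0 + u)) (f := fun x => x - lam0) lam0
    (by rw [sub_self]; exact h2) h3
  simpa [Function.comp_def] using h4

/-- Only degree one contributes at the origin, and each linear monomial has a single index, so its
coefficient is exactly the partial derivative. -/
theorem fderiv_sum_coordMonomial_single (c : MonomialIndex d (p + 1) → ℝ) (j : Fin d) :
    fderiv ℝ (fun u => ∑ s, c s * coordMonomial s.2 u) 0 (EuclideanSpace.single j 1)
      = c (linearIndex p j) := by
  rw [fderiv_fun_sum fun s _ => (differentiable_coordMonomial s.2 0).const_mul _,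
    sum_apply, Finset.sum_eq_single (linearIndex p j)]
  · rw [fderiv_const_mul (differentiable_coordMonomial _ 0), smul_apply,
      smul_eq_mul]
    have : fderiv ℝ (coordMonomial (linearIndex p j).2) 0 (EuclideanSpace.single j 1) = 1 := by
      refine (fderiv_coordMonomial_single (k := 0) (fun _ => j) 0 j).trans ?_
      simp [coordMonomial]
    rw [this, mul_one]
  · intro s _ hs
    rw [fderiv_const_mul (differentiable_coordMonomial _ 0), smul_apply,
      smul_eq_mul]
    refine mul_eq_zero_of_right _ ?_
    obtain ⟨⟨k, hk⟩, α⟩ := s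
    match k, hk, α with
    | 0, hk, α =>
      rw [(hasFDerivAt_coordMonomial α 0).fderiv]
      simp
    | 1, hk, α =>
      refine (fderiv_coordMonomial_single (k := 0) α 0 j).trans ?_
      have hα : α 0 ≠ j := by
        intro h
        apply hs
        have : α = fun _ => j := by
          ext i
          rw [Subsingleton.elim i 0, h]
        rw [this]
        rfl
      simp [hα]
    | k + 2, hk, α =>
      refine (fderiv_coordMonomial_single (k := k + 1) α 0 j).trans ?_
      simp [coordMonomial]
  · simp

end Bias

/-! ### The estimator -/

section Estimator

open scoped RealInnerProductSpace

variable {d n p : ℕ} {K : EuclideanSpace ℝ (Fin d) → ℝ}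
  {f : EuclideanSpace ℝ (Fin d) → EuclideanSpace ℝ (Fin n) → ℝ}
  {φ : EuclideanSpace ℝ (Fin n) → ℝ} {lam0 : EuclideanSpace ℝ (Fin d)}

/-- One unnormalized summand of the estimator. -/
noncomputable def kernelScore (K : EuclideanSpace ℝ (Fin d) → ℝ)
    (φ : EuclideanSpace ℝ (Fin n) → ℝ) (lam0 : EuclideanSpace ℝ (Fin d)) (h : ℝ)
    (q : EuclideanSpace ℝ (Fin d) × EuclideanSpace ℝ (Fin n)) : EuclideanSpace ℝ (Fin d) :=
  φ q.2 • gradient K (h⁻¹ • (lam0 - q.1))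

theorem inner_kernelScore (K : EuclideanSpace ℝ (Fin d) → ℝ)
    (φ : EuclideanSpace ℝ (Fin n) → ℝ) (lam0 : EuclideanSpace ℝ (Fin d)) (h : ℝ)
    (q : EuclideanSpace ℝ (Fin d) × EuclideanSpace ℝ (Fin n)) (t : EuclideanSpace ℝ (Fin d)) :
    ⟪kernelScore K φ lam0 h q, t⟫ = φ q.2 * ⟪gradient K (h⁻¹ • (lam0 - q.1)), t⟫ := by
  rw [kernelScore, real_inner_smul_left]

theorem KernelAssumption.aestronglyMeasurable_kernelScore (hK : KernelAssumption K p)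
    (hφ : AEStronglyMeasurable φ) (ℓ : EuclideanSpace ℝ (Fin d) → ℝ)
    (f : EuclideanSpace ℝ (Fin d) → EuclideanSpace ℝ (Fin n) → ℝ)
    (lam0 : EuclideanSpace ℝ (Fin d)) (h : ℝ) :
    AEStronglyMeasurable (kernelScore K φ lam0 h) (randomizedLaw ℓ f lam0) := by
  have h1 : AEStronglyMeasurable
      (fun q : EuclideanSpace ℝ (Fin d) × EuclideanSpace ℝ (Fin n) => φ q.2)
      (Measure.prod volume volume) :=
    hφ.comp_quasiMeasurePreserving Measure.quasiMeasurePreserving_snd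
  have h2 : Continuous fun q : EuclideanSpace ℝ (Fin d) × EuclideanSpace ℝ (Fin n) =>
      gradient K (h⁻¹ • (lam0 - q.1)) := hK.continuous_gradient.comp (by fun_prop)
  exact (h1.mono_ac (randomizedLaw_absolutelyContinuous _ _ _)).smul h2.aestronglyMeasurable

theorem ae_norm_kernelScore_le {A B : ℝ} (hA : ∀ l, ‖gradient K l‖ ≤ A) (hB : ∀ᵐ z, |φ z| ≤ B)
    (ℓ : EuclideanSpace ℝ (Fin d) → ℝ)
    (f : EuclideanSpace ℝ (Fin d) → EuclideanSpace ℝ (Fin n) → ℝ)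
    (lam0 : EuclideanSpace ℝ (Fin d)) (h : ℝ) :
    ∀ᵐ q ∂(randomizedLaw ℓ f lam0), ‖kernelScore K φ lam0 h q‖ ≤ B * A := by
  have hB2 : ∀ᵐ q ∂((volume : Measure (EuclideanSpace ℝ (Fin d))).prod
      (volume : Measure (EuclideanSpace ℝ (Fin n)))), |φ q.2| ≤ B :=
    Measure.quasiMeasurePreserving_snd.ae hB
  filter_upwards [(randomizedLaw_absolutelyContinuous ℓ f lam0).ae_le hB2] with q hq
  rw [kernelScore, norm_smul, Real.norm_eq_abs]
  exact mul_le_mul hq (hA _) (norm_nonneg _) ((abs_nonneg _).trans hq)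

/-- This makes the mean of a summand vanish in the limit, so its variance and second moment share
the same limit. -/
theorem KernelAssumption.integral_inner_gradient (hK : KernelAssumption K p)
    (t : EuclideanSpace ℝ (Fin d)) : ∫ l, ⟪gradient K l, t⟫ = 0 := by
  simp_rw [PiLp.inner_apply]
  have hi : ∀ j, Integrable fun l => gradient K l j := fun j =>
    (hK.continuous_gradient_coord j).integrable_of_hasCompactSupport
      (hK.hasCompactSupport_gradient_coord j)
  simp only [RCLike.inner_apply, conj_trivial]
  rw [integral_finsetSum _ fun j _ => (hi j).const_mul _]
  refine Finset.sum_eq_zero fun j _ => ?_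
  have h := hK.integral_gradient_mul_const j Fin.elim0
  simp only [coordMonomial, Finset.univ_eq_empty, Finset.prod_empty, mul_one] at h
  rw [integral_const_mul, h, mul_zero]

/-- The centred and rescaled summand of the estimator. -/
noncomputable def centeredScore (K : EuclideanSpace ℝ (Fin d) → ℝ)
    (φ : EuclideanSpace ℝ (Fin n) → ℝ) (lam0 : EuclideanSpace ℝ (Fin d)) (h : ℝ)
    (M : EuclideanSpace ℝ (Fin d))
    (q : EuclideanSpace ℝ (Fin d) × EuclideanSpace ℝ (Fin n)) : EuclideanSpace ℝ (Fin d) :=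
  (2 : ℝ) ^ d • (kernelScore K φ lam0 h q - M)

/-- Asymptotic normality of the centred estimator, written as a normalized sum. -/
theorem KernelAssumption.tendstoInDistribution_sum_centeredScore (hK : KernelAssumption K p)
    {Ω : Type*} [MeasurableSpace Ω] {P : Measure Ω} [IsProbabilityMeasure P]
    (hf : IsDensityFamily f) (hc : ∀ z, ContinuousAt (fun lam => f lam z) lam0)
    (hφ : AEStronglyMeasurable φ) {B : ℝ} (hB : ∀ᵐ z, |φ z| ≤ B)
    {h : ℕ → ℝ} (h_pos : ∀ N, 0 < h N) (h_lim : Tendsto h atTop (𝓝 0))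
    {X : (N : ℕ) → Fin N → Ω → EuclideanSpace ℝ (Fin d) × EuclideanSpace ℝ (Fin n)}
    (hX : ∀ N i, HasLaw (X N i) (randomizedLaw (uniformCubeDensity d (h N)) f lam0) P)
    (hindep : ∀ N, iIndepFun (X N) P) :
    TendstoInDistribution
      (fun (N : ℕ) ω => (√(N : ℝ))⁻¹ • ∑ i, centeredScore K φ lam0 (h N)
        (∫ q, kernelScore K φ lam0 (h N) q
          ∂(randomizedLaw (uniformCubeDensity d (h N)) f lam0)) (X N i ω)) atTop
      id (fun _ => P)
      (multivariateGaussian 0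
        (asymptoticCovariance K (densityMean f (fun z => φ z ^ 2) lam0))) := by
  set μ : ℕ → Measure (EuclideanSpace ℝ (Fin d) × EuclideanSpace ℝ (Fin n)) := fun N =>
    randomizedLaw (uniformCubeDensity d (h N)) f lam0 with hμ
  have hprob : ∀ N, IsProbabilityMeasure (μ N) := fun N =>
    hf.isProbabilityMeasure_randomizedLaw lam0 (h_pos N)
  have hmap : ∀ N i, P.map (X N i) = μ N := fun N i => (hX N i).map_eq
  obtain ⟨A, hA⟩ := hK.exists_norm_gradient_le
  have hSm : ∀ N, AEStronglyMeasurable (kernelScore K φ lam0 (h N)) (μ N) := fun N =>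
    hK.aestronglyMeasurable_kernelScore hφ _ f lam0 (h N)
  have hSb : ∀ N, ∀ᵐ q ∂(μ N), ‖kernelScore K φ lam0 (h N) q‖ ≤ B * A := fun N =>
    ae_norm_kernelScore_le hA hB _ f lam0 (h N)
  have hSi : ∀ N, Integrable (kernelScore K φ lam0 (h N)) (μ N) := fun N =>
    Integrable.of_bound (hSm N) _ (hSb N)
  set M : ℕ → EuclideanSpace ℝ (Fin d) := fun N => ∫ q, kernelScore K φ lam0 (h N) q ∂(μ N)
    with hM
  have hMb : ∀ N, ‖M N‖ ≤ B * A := fun N =>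
    (norm_integral_le_of_norm_le_const (hSb N)).trans (by simp)
  have hCm : ∀ N, AEMeasurable (centeredScore K φ lam0 (h N) (M N)) (μ N) := fun N =>
    (((hSm N).sub aestronglyMeasurable_const).const_smul ((2 : ℝ) ^ d)).aemeasurable
  have hprob' : ∀ N, IsProbabilityMeasure
      ((μ N).map (centeredScore K φ lam0 (h N) (M N))) := fun N =>
    Measure.isProbabilityMeasure_map (hCm N)
  have hSti : ∀ N t, Integrable (fun q => ⟪kernelScore K φ lam0 (h N) q, t⟫) (μ N) :=
    fun N t => (hSi N).inner_const t
  have hMt : ∀ N t, ⟪M N, t⟫ = ∫ q, ⟪kernelScore K φ lam0 (h N) q, t⟫ ∂(μ N) := by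
    intro N t
    rw [real_inner_comm, hM, ← integral_inner (hSi N) t]
    simp_rw [real_inner_comm]
  have hSti2 : ∀ N t, Integrable (fun q => ⟪kernelScore K φ lam0 (h N) q, t⟫ ^ 2) (μ N) := by
    intro N t
    refine Integrable.of_bound ((hSti N t).aestronglyMeasurable.pow 2) ((B * A * ‖t‖) ^ 2) ?_
    filter_upwards [hSb N] with q hq
    rw [norm_pow, Real.norm_eq_abs]
    have := (abs_real_inner_le_norm (kernelScore K φ lam0 (h N) q) t).trans
      (mul_le_mul_of_nonneg_right hq (norm_nonneg t))
    gcongr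
  -- In the constant, one `B * A` bounds the score and the other its mean.
  refine tendstoInDistribution_inv_sqrt_smul_sum
    (ν := fun N => (μ N).map (centeredScore K φ lam0 (h N) (M N)))
    (C := (2 : ℝ) ^ d * (B * A + B * A)) (fun N i => ⟨?_, ?_⟩) (fun N => ?_) (fun N => ?_)
    (fun N t => ?_) (hK.posSemidef_asymptoticCovariance ?_) (fun t => ?_)
  · have := hCm N
    rw [← hmap N i] at this
    exact this.comp_aemeasurable (hX N i).aemeasurable
  · have := hCm N
    rw [← hmap N i] at this
    have h2 := AEMeasurable.map_map_of_aemeasurable this (hX N i).aemeasurable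
    rw [hmap N i] at h2
    exact h2.symm
  · refine (hindep N).comp₀ (fun _ => centeredScore K φ lam0 (h N) (M N))
      (fun i => (hX N i).aemeasurable) fun i => ?_
    rw [(hX N i).map_eq]
    exact hCm N
  · rw [ae_map_iff (hCm N) (measurableSet_le measurable_norm measurable_const)]
    filter_upwards [hSb N] with q hq
    rw [centeredScore, norm_smul, Real.norm_of_nonneg (by positivity)]
    gcongr
    exact (norm_sub_le _ _).trans (add_le_add hq (hMb N))
  · rw [integral_map (hCm N) (by fun_prop)]
    simp_rw [centeredScore, real_inner_smul_left, inner_sub_left]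
    rw [integral_const_mul, integral_sub (hSti N t) (integrable_const _), ← hMt]
    simp
  · exact integral_nonneg fun z => mul_nonneg (sq_nonneg _) (hf.nonneg _ _)
  · have e : ∀ N, ∫ x, ⟪x, t⟫ ^ 2 ∂((μ N).map (centeredScore K φ lam0 (h N) (M N)))
        = ((2 : ℝ) ^ d) ^ 2 * ((∫ q, ⟪kernelScore K φ lam0 (h N) q, t⟫ ^ 2 ∂(μ N))
          - (∫ q, ⟪kernelScore K φ lam0 (h N) q, t⟫ ∂(μ N)) ^ 2) := by
      intro N
      rw [integral_map (hCm N) (by fun_prop)]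
      simp_rw [centeredScore, real_inner_smul_left, inner_sub_left, mul_pow]
      rw [integral_const_mul, ← hMt]
      congr 1
      have e1 : ∀ q, (⟪kernelScore K φ lam0 (h N) q, t⟫ - ⟪M N, t⟫) ^ 2
          = ⟪kernelScore K φ lam0 (h N) q, t⟫ ^ 2
            - (2 * ⟪M N, t⟫ * ⟪kernelScore K φ lam0 (h N) q, t⟫ - ⟪M N, t⟫ ^ 2) := by
        intro q
        ring
      have i1 : Integrable (fun q => 2 * ⟪M N, t⟫ * ⟪kernelScore K φ lam0 (h N) q, t⟫) (μ N) :=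
        (hSti N t).const_mul _
      have i2 : Integrable (fun q => 2 * ⟪M N, t⟫ * ⟪kernelScore K φ lam0 (h N) q, t⟫
          - ⟪M N, t⟫ ^ 2) (μ N) := i1.sub (integrable_const _)
      simp_rw [e1]
      rw [integral_sub (hSti2 N t) i2,
        integral_sub i1 (integrable_const _), integral_const_mul, ← hMt]
      simp
      ring
    simp_rw [e, inner_kernelScore, mul_pow]
    have hB2 : ∀ᵐ z, |φ z ^ 2| ≤ B ^ 2 := by
      filter_upwards [hB] with z hz
      rw [abs_pow]
      gcongr
    have hk := hK.continuous_inner_gradient t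
    have hks := hK.support_inner_gradient t
    have hks2 : (Function.support fun l => ⟪gradient K l, t⟫ ^ 2) ⊆ closedCube d 1 :=
      fun l hl => hks fun h0 => hl (by simp only [h0]; norm_num)
    have l1 := hf.tendsto_integral_randomizedLaw (ψ := fun z => φ z ^ 2)
      (k := fun l => ⟪gradient K l, t⟫ ^ 2) hc (hφ.pow 2) hB2 (hk.pow 2) hks2 h_pos h_lim
    have l2 := hf.tendsto_integral_randomizedLaw hc hφ hB hk hks h_pos h_lim
    have l3 := (l1.sub (l2.pow 2)).const_mul (((2 : ℝ) ^ d) ^ 2)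
    -- The squared mean drops out of the limit, and `(2^d)² · 2^{-d}` leaves the factor `2^d` of the
    -- covariance.
    rw [hK.integral_inner_gradient] at l3
    rw [hK.dotProduct_asymptoticCovariance]
    convert! l3 using 2
    have : (2 : ℝ) ^ d ≠ 0 := by positivity
    simp only [WithLp.toLp_ofLp]
    field_simp
    ring

/-- Coordinates of the mean of a summand. -/
theorem KernelAssumption.integral_kernelScore_coord (hK : KernelAssumption K p)
    (hf : IsDensityFamily f) (hφ : AEStronglyMeasurable φ) {B : ℝ} (hB : ∀ᵐ z, |φ z| ≤ B)
    {h : ℝ} (hh : 0 < h) (j : Fin d) :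
    (∫ q, kernelScore K φ lam0 h q ∂(randomizedLaw (uniformCubeDensity d h) f lam0)) j
      = ((2 : ℝ) ^ d)⁻¹ * ∫ l, gradient K l j * densityMean f φ (lam0 - h • l) := by
  have hprob := hf.isProbabilityMeasure_randomizedLaw lam0 hh
  obtain ⟨A, hA⟩ := hK.exists_norm_gradient_le
  obtain ⟨A', hA'⟩ := (hK.hasCompactSupport_gradient_coord j).exists_bound_of_continuous
    (hK.continuous_gradient_coord j)
  have hi : Integrable (kernelScore K φ lam0 h)
      (randomizedLaw (uniformCubeDensity d h) f lam0) :=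
    Integrable.of_bound (hK.aestronglyMeasurable_kernelScore hφ _ f lam0 h) _
      (ae_norm_kernelScore_le hA hB _ f lam0 h)
  have h1 := (EuclideanSpace.proj j : EuclideanSpace ℝ (Fin d) →L[ℝ] ℝ).integral_comp_comm hi
  rw [← hf.integral_randomizedLaw lam0 hh hφ hB (hK.continuous_gradient_coord j)
    (hK.support_gradient_coord j) hA']
  exact h1.symm

/-- Convergence in Euclidean space is coordinatewise. -/
theorem EuclideanSpace.tendsto_of_forall_coord {ι : Type*} {l : Filter ι}
    {x : ι → EuclideanSpace ℝ (Fin d)} {a : EuclideanSpace ℝ (Fin d)}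
    (hx : ∀ j, Tendsto (fun i => x i j) l (𝓝 (a j))) : Tendsto x l (𝓝 a) :=
  ((PiLp.continuous_toLp 2 fun _ : Fin d => ℝ).tendsto a.ofLp).comp
    (tendsto_pi_nhds.2 hx)

theorem TimesDifferentiable.continuous {k : ℕ} {g : EuclideanSpace ℝ (Fin d) → ℝ}
    (hg : TimesDifferentiable (k + 1) g) : Continuous g := by
  have h := (ContinuousMultilinearMap.apply ℝ (fun _ : Fin 0 => EuclideanSpace ℝ (Fin d)) ℝ
    Fin.elim0).continuous.comp (hg 0 (by omega)).continuous
  exact h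

/-- Either integrability condition dominates the oscillation of the highest derivative. -/
theorem RegularityAssumption.exists_dominated_oscillation (hR : RegularityAssumption f φ lam0 p)
    (hφ : Integrable φ ∨ LocallyDominated (p + 1) f φ lam0) :
    ∃ r > 0, ∃ G : EuclideanSpace ℝ (Fin n) → ℝ, Integrable G ∧
      ∀ᵐ z, ∀ lam ∈ Metric.ball lam0 r,
        |φ z| * ‖iteratedFDeriv ℝ (p + 1) (fun l => f l z) lam
          - iteratedFDeriv ℝ (p + 1) (fun l => f l z) lam0‖ ≤ G z := by
  rcases hφ with hφ | ⟨r, hr, g, hg, hdom⟩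
  · obtain ⟨S, hS, hunif⟩ := hR.uniform_continuity
    -- Tolerance one suffices: the oscillation only has to be bounded on the support of `φ`, so that
    -- `|φ|` itself dominates.
    have h1 := Metric.tendstoUniformlyOn_iff.1 (hunif (p + 1) le_rfl) 1 one_pos
    obtain ⟨r, hr, hball⟩ := Metric.eventually_nhds_iff_ball.1 h1
    refine ⟨r, hr, fun z => |φ z|, hφ.abs, ae_of_all _ fun z lam hlam => ?_⟩
    by_cases hz : z ∈ tsupport φ
    · refine mul_le_of_le_one_right (abs_nonneg _) ?_
      rw [← dist_eq_norm, dist_comm]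
      exact (hball lam hlam z (interior_subset (hS hz))).le
    · simp [image_eq_zero_of_notMem_tsupport hz]
  · refine ⟨r, hr, fun z => 2 * g z, hg.const_mul 2, ?_⟩
    filter_upwards [hdom] with z hz lam hlam
    calc _ ≤ |φ z| * (‖iteratedFDeriv ℝ (p + 1) (fun l => f l z) lam‖
          + ‖iteratedFDeriv ℝ (p + 1) (fun l => f l z) lam0‖) := by
          gcongr
          exact norm_sub_le _ _
      _ ≤ 2 * g z := by
          rw [mul_add, two_mul]
          exact add_le_add (hz lam hlam) (hz lam0 (Metric.mem_ball_self hr))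

theorem exists_ae_abs_le_of_memLp_top (hφ : MemLp φ ⊤ volume) : ∃ B, ∀ᵐ z, |φ z| ≤ B := by
  refine ⟨(eLpNorm φ ⊤ volume).toReal, ?_⟩
  filter_upwards [ae_le_eLpNormEssSup (f := φ) (μ := volume)] with z hz
  rw [← eLpNorm_exponent_top] at hz
  have := ENNReal.toReal_mono hφ.eLpNorm_ne_top hz
  simpa using this

end Estimator

/-! ### Proof of the theorem -/

theorem uniformKernelEstimator_eq {d n : ℕ} (K : EuclideanSpace ℝ (Fin d) → ℝ)
    (φ : EuclideanSpace ℝ (Fin n) → ℝ) (lam0 : EuclideanSpace ℝ (Fin d)) (N : ℕ) (h : ℝ)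
    (L : Fin N → EuclideanSpace ℝ (Fin d)) (z : Fin N → EuclideanSpace ℝ (Fin n)) :
    uniformKernelEstimator K φ lam0 N h L z
      = ((2 : ℝ) ^ d / (N * h)) • ∑ i, kernelScore K φ lam0 h (L i, z i) := rfl

theorem theorem4p3 {d n p : ℕ}
    {Ω : Type*} [MeasurableSpace Ω] (P : Measure Ω) [IsProbabilityMeasure P]
    -- the parametric family `Z(λ)` and its densities `f(λ, ·)`
    (Zpar : EuclideanSpace ℝ (Fin d) → Ω → EuclideanSpace ℝ (Fin n))
    (f : EuclideanSpace ℝ (Fin d) → EuclideanSpace ℝ (Fin n) → ℝ)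
    (hf_meas : Measurable (Function.uncurry f))
    (hf_nonneg : ∀ lam z, 0 ≤ f lam z)
    (hZpar : ∀ lam, HasLaw (Zpar lam)
      ((volume : Measure (EuclideanSpace ℝ (Fin n))).withDensity
        (fun z => ENNReal.ofReal (f lam z))) P)
    -- the parameter of interest, the payoff and the kernel
    (lam0 : EuclideanSpace ℝ (Fin d))
    (φ : EuclideanSpace ℝ (Fin n) → ℝ) (hφ : MemLp φ ⊤ volume)
    (K : EuclideanSpace ℝ (Fin d) → ℝ)
    (hK : KernelAssumption K p)
    (hR : RegularityAssumption f φ lam0 p)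
    -- the bandwidths and, for every `N`, an i.i.d. sample of size `N`
    (h : ℕ → ℝ) (h_pos : ∀ N, 0 < h N)
    (Lam : (N : ℕ) → Fin N → Ω → EuclideanSpace ℝ (Fin d))
    (Z : (N : ℕ) → Fin N → Ω → EuclideanSpace ℝ (Fin n))
    (h_law : ∀ N i, HasLaw (fun ω => (Lam N i ω, Z N i ω))
      (randomizedLaw (uniformCubeDensity d (h N)) f lam0) P)
    (h_indep : ∀ N, iIndepFun (fun i ω => (Lam N i ω, Z N i ω)) P)
    (h_lim : Tendsto h atTop (𝓝 0))
    (h_rate : Tendsto (fun N : ℕ => (N : ℝ) * h N ^ 2) atTop atTop) :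
    let V : EuclideanSpace ℝ (Fin d) → ℝ := fun lam => ∫ ω, φ (Zpar lam ω) ∂P
    let β : EuclideanSpace ℝ (Fin d) := gradient V lam0
    let βhat : ℕ → Ω → EuclideanSpace ℝ (Fin d) := fun N ω =>
      uniformKernelEstimator K φ lam0 N (h N) (fun i => Lam N i ω) (fun i => Z N i ω)
    let covu : Matrix (Fin d) (Fin d) ℝ :=
      asymptoticCovariance K (∫ ω, φ (Zpar lam0 ω) ^ 2 ∂P)
    -- (i) asymptotic normality around the mean
    ((∀ N, Integrable (βhat N) P) ∧
      TendstoInDistribution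
        (fun (N : ℕ) ω => √((N : ℝ) * h N ^ 2) • (βhat N ω - ∫ ω', βhat N ω' ∂P)) atTop
        id (fun _ => P) (multivariateGaussian 0 covu)) ∧
    -- (ii) the bias vanishes, and asymptotic normality around `β = ∇V(lam0)`
    (Tendsto (fun N : ℕ => (N : ℝ) * h N ^ (2 * p + 2)) atTop (𝓝 0) →
      (Integrable φ ∨ LocallyDominated (p + 1) f φ lam0) →
      DifferentiableAt ℝ V lam0 ∧
      Tendsto (fun N => ∫ ω, βhat N ω ∂P) atTop (𝓝 β) ∧
      Tendsto (fun N : ℕ => √((N : ℝ) * h N ^ 2) • ((∫ ω, βhat N ω ∂P) - β)) atTop (𝓝 0) ∧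
      TendstoInDistribution
        (fun (N : ℕ) ω => √((N : ℝ) * h N ^ 2) • (βhat N ω - β)) atTop
        id (fun _ => P) (multivariateGaussian 0 covu)) := by
  intro V β βhat covu
  have hf := IsDensityFamily.of_hasLaw hf_meas hf_nonneg hZpar
  have hφm := hφ.aestronglyMeasurable
  obtain ⟨B, hB⟩ := exists_ae_abs_le_of_memLp_top hφ
  have hc : ∀ z, ContinuousAt (fun lam => f lam z) lam0 := fun z =>
    (hR.timesDifferentiable z).continuous.continuousAt
  have hV : V = densityMean f φ := funext fun lam =>
    hf.integral_comp_eq_densityMean (hZpar lam) hφm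
  have hm : ∫ ω, φ (Zpar lam0 ω) ^ 2 ∂P = densityMean f (fun z => φ z ^ 2) lam0 :=
    hf.integral_comp_eq_densityMean (ψ := fun z => φ z ^ 2) (hZpar lam0) (hφm.pow 2)
  obtain ⟨A, hA⟩ := hK.exists_norm_gradient_le
  let M : ℕ → EuclideanSpace ℝ (Fin d) := fun N =>
    ∫ q, kernelScore K φ lam0 (h N) q ∂(randomizedLaw (uniformCubeDensity d (h N)) f lam0)
  have hSm : ∀ N, AEStronglyMeasurable (kernelScore K φ lam0 (h N))
      (randomizedLaw (uniformCubeDensity d (h N)) f lam0) := fun N =>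
    hK.aestronglyMeasurable_kernelScore hφm _ f lam0 (h N)
  have hSi : ∀ N i, Integrable (fun ω => kernelScore K φ lam0 (h N) (Lam N i ω, Z N i ω)) P := by
    intro N i
    have hprob := hf.isProbabilityMeasure_randomizedLaw lam0 (h_pos N)
    have h1 : Integrable (kernelScore K φ lam0 (h N)) (P.map fun ω => (Lam N i ω, Z N i ω)) := by
      rw [(h_law N i).map_eq]
      exact Integrable.of_bound (hSm N) _ (ae_norm_kernelScore_le hA hB _ f lam0 (h N))
    exact h1.comp_aemeasurable (h_law N i).aemeasurable
  have hSM : ∀ N i, ∫ ω, kernelScore K φ lam0 (h N) (Lam N i ω, Z N i ω) ∂P = M N :=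
    fun N i => (h_law N i).integral_comp (hSm N)
  have hint : ∀ N, Integrable (βhat N) P := fun N =>
    (integrable_finsetSum Finset.univ fun i _ => hSi N i).smul ((2 : ℝ) ^ d / (N * h N))
  have hmean : ∀ N, ∫ ω, βhat N ω ∂P = ((2 : ℝ) ^ d / (N * h N)) • ((N : ℝ) • M N) := by
    intro N
    simp only [βhat, uniformKernelEstimator_eq]
    rw [integral_smul, integral_finsetSum _ fun i _ => hSi N i]
    simp only [hSM, Finset.sum_const, Finset.card_univ, Fintype.card_fin, Nat.cast_smul_eq_nsmul]
  have hnorm : TendstoInDistribution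
      (fun (N : ℕ) ω => √((N : ℝ) * h N ^ 2) • (βhat N ω - ∫ ω', βhat N ω' ∂P)) atTop
      id (fun _ => P) (multivariateGaussian 0 covu) := by
    have hclt := hK.tendstoInDistribution_sum_centeredScore hf hc hφm hB h_pos h_lim
      h_law h_indep
    rw [← hm] at hclt
    refine hclt.congr (fun N => ae_of_all _ fun ω => ?_) (ae_of_all _ fun _ => rfl)
    rw [hmean]
    simp only [centeredScore, βhat, uniformKernelEstimator_eq, ← Finset.smul_sum,
      Finset.sum_sub_distrib, Finset.sum_const, Finset.card_univ, Fintype.card_fin,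
      ← Nat.cast_smul_eq_nsmul ℝ]
    rw [← smul_sub, smul_smul, smul_smul]
    congr 1
    have hpos := h_pos N
    -- What remains is `2^d / √N = √(N h²) · 2^d / (N h)`. For `N = 0` both scalars are zero by the
    -- conventions for `√0` and division by zero.
    rcases Nat.eq_zero_or_pos N with rfl | hN
    · simp
    · have hN' : (0 : ℝ) < N := by exact_mod_cast hN
      have hs : 0 < √(N : ℝ) := Real.sqrt_pos.2 hN'
      rw [Real.sqrt_mul hN'.le, Real.sqrt_sq hpos.le]
      have hsq : √(N : ℝ) ^ 2 = N := Real.sq_sqrt hN'.le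
      field_simp
      rw [hsq]
  refine ⟨⟨hint, hnorm⟩, fun hrate2 hdom => ?_⟩
  obtain ⟨r, hr, G, hG, hosc⟩ := hR.exists_dominated_oscillation hdom
  obtain ⟨c, C, hexp⟩ :=
    hf.exists_densityMean_expansion hR.timesDifferentiable hφm hB hG hosc
  have hp := hK.two_le
  have hderiv := hasFDerivAt_of_coordMonomial_expansion (by omega) hr hexp
  rw [← hV] at hderiv
  have hβ : ∀ j, β j = c (linearIndex p j) := by
    intro j
    rw [← fderiv_sum_coordMonomial_single c j, ← hderiv.fderiv]
    exact gradient_coord V lam0 j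
  have hcoord : ∀ N, 0 < N → ∀ j, (∫ ω, βhat N ω ∂P) j
      = (h N)⁻¹ * ∫ l, gradient K l j * densityMean f φ (lam0 - h N • l) := by
    intro N hN j
    have hN' : (N : ℝ) ≠ 0 := by exact_mod_cast hN.ne'
    have hpos := (h_pos N).ne'
    rw [hmean, PiLp.smul_apply, PiLp.smul_apply, smul_eq_mul, smul_eq_mul,
      hK.integral_kernelScore_coord hf hφm hB (h_pos N) j]
    field_simp
  have hbias : ∀ j, ∃ A : ℝ, ∀ᶠ N in atTop, |(∫ ω, βhat N ω ∂P) j - β j| ≤ A * h N ^ p := by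
    intro j
    obtain ⟨A, δ, hδ, hA⟩ :=
      hK.exists_bias_bound (hf.aestronglyMeasurable_densityMean hφm) hr hexp j
    refine ⟨A, ?_⟩
    filter_upwards [eventually_gt_atTop 0, h_lim.eventually (gt_mem_nhds hδ)] with N hN hNδ
    rw [hcoord N hN, hβ]
    exact hA _ (h_pos N) hNδ
  have hlim1 : Tendsto (fun N => ∫ ω, βhat N ω ∂P) atTop (𝓝 β) := by
    refine EuclideanSpace.tendsto_of_forall_coord fun j => ?_
    obtain ⟨A, hA⟩ := hbias j
    rw [tendsto_iff_norm_sub_tendsto_zero]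
    refine squeeze_zero' (Eventually.of_forall fun _ => norm_nonneg _) hA ?_
    have := (h_lim.pow p).const_mul A
    rwa [zero_pow (by omega), mul_zero] at this
  have hlim2 : Tendsto (fun N : ℕ => √((N : ℝ) * h N ^ 2) • ((∫ ω, βhat N ω ∂P) - β)) atTop
      (𝓝 0) := by
    refine EuclideanSpace.tendsto_of_forall_coord fun j => ?_
    obtain ⟨A, hA⟩ := hbias j
    have hs : Tendsto (fun N : ℕ => A * √((N : ℝ) * h N ^ (2 * p + 2))) atTop (𝓝 0) := by
      have := (Real.continuous_sqrt.tendsto 0 |>.comp hrate2).const_mul A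
      rwa [Real.sqrt_zero, mul_zero] at this
    refine squeeze_zero_norm' ?_ hs
    filter_upwards [hA] with N hN
    -- The rate condition is exactly that the bias bound `h^p`, multiplied by the normalization,
    -- tends to zero.
    have e : √((N : ℝ) * h N ^ (2 * p + 2)) = √((N : ℝ) * h N ^ 2) * h N ^ p := by
      rw [show (N : ℝ) * h N ^ (2 * p + 2) = (N * h N ^ 2) * (h N ^ p) ^ 2 by ring,
        Real.sqrt_mul (by positivity), Real.sqrt_sq (pow_nonneg (h_pos N).le p)]
    rw [PiLp.smul_apply, PiLp.sub_apply, smul_eq_mul, norm_mul,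
      Real.norm_of_nonneg (Real.sqrt_nonneg _), Real.norm_eq_abs, e]
    calc _ ≤ √((N : ℝ) * h N ^ 2) * (A * h N ^ p) := by gcongr
      _ = _ := by ring
  refine ⟨hderiv.differentiableAt, hlim1, hlim2, ?_⟩
  -- Slutsky, with the scaled bias viewed as a deterministic sequence converging in measure to zero.
  have hslutsky := hnorm.add_of_tendstoInMeasure_const
    (Y := fun (N : ℕ) (_ : Ω) => √((N : ℝ) * h N ^ 2) • ((∫ ω, βhat N ω ∂P) - β)) (c := 0)
    (tendstoInMeasure_of_tendsto_ae (fun _ => aestronglyMeasurable_const)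
      (ae_of_all _ fun _ => hlim2)) (fun _ => aemeasurable_const)
  refine hslutsky.congr (fun N => ae_of_all _ fun ω => ?_) (ae_of_all _ fun ω => ?_)
  · simp only [Pi.add_apply, ← smul_add, sub_add_sub_cancel]
  · simp
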